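/- Let $M$ be a smooth manifold (Hausdorff, second countable, without boundary) carrying a contact pair $(\alpha_1,\alpha_2)$ of type $(h,k)$, $h,k\ge 0$; that is, $\alpha_1,\alpha_2$ are smooth $1$-forms on $M$ such that $\alpha_1\wedge(d\alpha_1)^h\wedge\alpha_2\wedge(d\alpha_2)^k$ is a volume form (so that $\dim M=2h+2k+2$), $(d\alpha_1)^{h+1}=0$ and $(d\alpha_2)^{k+1}=0$. Let $T\mathcal F_i=\ker\alpha_i\cap\ker d\alpha_i$, $i=1,2$, be the characteristic distributions, where $\ker d\alpha_i=\{v: d\alpha_i(v,w)=0 \text{ for all } w\}$. Then $T\mathcal F_1$ and $T\mathcal F_2$ are smooth involutive subbundles of $TM$, of ranks $2k+1$ and $2h+1$ respectively, hence tangent to foliations $\mathcal F_1,\mathcal F_2$ (the characteristic foliations), and there exists a smooth Riemannian metric $g$ on $M$ such that 1. $\mathcal F_1$ and $\mathcal F_2$ are orthogonal: $g(v,w)=0$ for all $x\in M$, $v\in T_x\mathcal F_1$, $w\in T_x\mathcal F_2$; 2. $\mathcal F_1$ and $\mathcal F_2$ are minimal, i.e. their leaves are minimal submanifolds of $(M,g)$: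 for $i=1,2$ and every smooth local orthonormal frame $e_1,\dots,e_p$ of $T\mathcal F_i$ ($p=\operatorname{rank}T\mathcal F_i$), the component of $\sum_{j=1}^p\nabla_{e_j}e_j$ orthogonal to $T\mathcal F_i$ vanishes, where $\nabla$ is the Levi-Civita connection of $g$. -/

import Mathlib

open Bundle Set
open scoped Manifold ContDiff Topology

noncomputable section

namespace ContactPair

/-! ### Exterior algebra on a real vector space -/

section Algebra

variable {V : Type*} [AddCommGroup V] [Module ℝ V]

/-- The wedge product of two alternating forms (shuffle convention:
`(θ ∧ η)(v₁, …, v_{a+b})` is the signed sum over the `(a, b)`-shuffles). -/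
def wedge {a b : ℕ} (θ : V [⋀^Fin a]→ₗ[ℝ] ℝ) (η : V [⋀^Fin b]→ₗ[ℝ] ℝ) :
    V [⋀^Fin (a + b)]→ₗ[ℝ] ℝ :=
  ((LinearMap.mul' ℝ ℝ).compAlternatingMap (θ.domCoprod η)).domDomCongr finSumFinEquiv

/-- The `m`-th wedge power `θ ∧ ⋯ ∧ θ` of a `2`-form; the power `θ ^ 0` is the constant `1`. -/
def wedgePow (θ : V [⋀^Fin 2]→ₗ[ℝ] ℝ) : (m : ℕ) → V [⋀^Fin (2 * m)]→ₗ[ℝ] ℝ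
  | 0 => (AlternatingMap.constOfIsEmpty ℝ V (Fin 0) (1 : ℝ) : V [⋀^Fin 0]→ₗ[ℝ] ℝ)
  | m + 1 => wedge (wedgePow θ m) θ

/-- A linear form seen as an alternating `1`-form. -/
def oneForm (a : V →ₗ[ℝ] ℝ) : V [⋀^Fin 1]→ₗ[ℝ] ℝ :=
  AlternatingMap.ofSubsingleton ℝ V ℝ (0 : Fin 1) a

end Algebra

/-! ### One-forms on a manifold and their exterior derivative -/

section Manifold

variable {n : ℕ} {M : Type*} [TopologicalSpace M] [ChartedSpace (EuclideanSpace ℝ (Fin n)) M]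

/-- Smoothness of a `1`-form, as a section of the cotangent bundle. -/
def IsSmoothOneForm [IsManifold (𝓡 n) ∞ M] (α : ∀ x : M, TangentSpace (𝓡 n) x →L[ℝ] ℝ) : Prop :=
  ContMDiff (𝓡 n) ((𝓡 n).prod 𝓘(ℝ, EuclideanSpace ℝ (Fin n) →L[ℝ] ℝ)) ∞
    (fun x ↦ TotalSpace.mk' (EuclideanSpace ℝ (Fin n) →L[ℝ] ℝ) x (α x))

/-- The expression of a `1`-form in the chart at `x₀`, i.e. its pullback under the inverse of
that chart. -/
def inChart (α : ∀ x : M, TangentSpace (𝓡 n) x →L[ℝ] ℝ) (x₀ : M)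
    (y : EuclideanSpace ℝ (Fin n)) : EuclideanSpace ℝ (Fin n) →L[ℝ] ℝ :=
  (α ((extChartAt (𝓡 n) x₀).symm y)).comp
    (mfderiv 𝓘(ℝ, EuclideanSpace ℝ (Fin n)) (𝓡 n) (extChartAt (𝓡 n) x₀).symm y)

/-- The exterior derivative `dα` of a `1`-form at `x₀`: the exterior derivative of the expression
of `α` in the chart at `x₀`, pulled back to the tangent space at `x₀`. -/
def extDerivOneForm (α : ∀ x : M, TangentSpace (𝓡 n) x →L[ℝ] ℝ) (x₀ : M) :
    TangentSpace (𝓡 n) x₀ [⋀^Fin 2]→L[ℝ] ℝ :=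
  (extDeriv (fun y ↦ ContinuousAlternatingMap.ofSubsingleton ℝ (EuclideanSpace ℝ (Fin n)) ℝ
      (0 : Fin 1) (inChart α x₀ y)) (extChartAt (𝓡 n) x₀ x₀)).compContinuousLinearMap
    (mfderiv (𝓡 n) 𝓘(ℝ, EuclideanSpace ℝ (Fin n)) (extChartAt (𝓡 n) x₀) x₀)

/-- The form `α₁ ∧ (dα₁)^h ∧ α₂ ∧ (dα₂)^k` at the point `x`. -/
def contactPairForm (h k : ℕ) (α₁ α₂ : ∀ x : M, TangentSpace (𝓡 n) x →L[ℝ] ℝ) (x : M) :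
    TangentSpace (𝓡 n) x [⋀^Fin (((1 + 2 * h) + 1) + 2 * k)]→ₗ[ℝ] ℝ :=
  wedge
    (wedge
      (wedge (oneForm (α₁ x : TangentSpace (𝓡 n) x →ₗ[ℝ] ℝ))
        (wedgePow (extDerivOneForm α₁ x).toAlternatingMap h))
      (oneForm (α₂ x : TangentSpace (𝓡 n) x →ₗ[ℝ] ℝ)))
    (wedgePow (extDerivOneForm α₂ x).toAlternatingMap k)

/-- A contact pair of type `(h, k)`: two smooth `1`-forms such that
`α₁ ∧ (dα₁)^h ∧ α₂ ∧ (dα₂)^k` is a volume form (it has top degree and vanishes nowhere),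
`(dα₁)^(h+1) = 0` and `(dα₂)^(k+1) = 0`. -/
structure IsContactPair [IsManifold (𝓡 n) ∞ M] (h k : ℕ)
    (α₁ α₂ : ∀ x : M, TangentSpace (𝓡 n) x →L[ℝ] ℝ) : Prop where
  smooth₁ : IsSmoothOneForm α₁
  smooth₂ : IsSmoothOneForm α₂
  dim_eq : n = 2 * h + 2 * k + 2
  volume : ∀ x : M, contactPairForm h k α₁ α₂ x ≠ 0
  pow_eq_zero₁ : ∀ x : M, wedgePow (extDerivOneForm α₁ x).toAlternatingMap (h + 1) = 0
  pow_eq_zero₂ : ∀ x : M, wedgePow (extDerivOneForm α₂ x).toAlternatingMap (k + 1) = 0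

/-- The characteristic distribution `ker α ∩ ker dα` of a `1`-form, where
`ker dα = {v | dα(v, w) = 0 for all w}`. -/
def charDistribution (α : ∀ x : M, TangentSpace (𝓡 n) x →L[ℝ] ℝ) (x : M) :
    Submodule ℝ (TangentSpace (𝓡 n) x) where
  carrier := {v | α x v = 0 ∧ ∀ w, extDerivOneForm α x ![v, w] = 0}
  zero_mem' := ⟨map_zero _, fun w ↦ (extDerivOneForm α x).map_coord_zero 0 rfl⟩
  add_mem' {u v} hu hv := ⟨by rw [map_add, hu.1, hv.1, add_zero], fun w ↦ by
    have := (extDerivOneForm α x).toAlternatingMap.map_vecCons_add ![w] u v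
    exact this.trans (by
      change extDerivOneForm α x ![u, w] + extDerivOneForm α x ![v, w] = 0
      rw [hu.2 w, hv.2 w, add_zero])⟩
  smul_mem' c v hv := ⟨by rw [map_smul, hv.1, smul_zero], fun w ↦ by
    have := (extDerivOneForm α x).toAlternatingMap.map_vecCons_smul ![w] c v
    exact this.trans (by
      change c • extDerivOneForm α x ![v, w] = 0
      rw [hv.2 w, smul_zero])⟩

/-! ### Foliations, the Levi-Civita connection, and minimality -/

/-- The vector field `X` is smooth on the set `U`. -/
def SmoothFieldOn [IsManifold (𝓡 n) ∞ M] (X : ∀ x : M, TangentSpace (𝓡 n) x) (U : Set M) : Prop :=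
  ContMDiffOn (𝓡 n) ((𝓡 n).prod 𝓘(ℝ, EuclideanSpace ℝ (Fin n))) ∞
    (fun x ↦ TotalSpace.mk' (EuclideanSpace ℝ (Fin n)) x (X x)) U

/-- The distribution `D` is the tangent distribution of a smooth `p`-dimensional foliation:
it is a smooth subbundle of rank `p` of the tangent bundle, and it is involutive. -/
structure IsFoliation [IsManifold (𝓡 n) ∞ M] (D : ∀ x : M, Submodule ℝ (TangentSpace (𝓡 n) x))
    (p : ℕ) : Prop where
  exists_frame : ∀ x : M, ∃ U : Set M, IsOpen U ∧ x ∈ U ∧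
    ∃ s : Fin p → ∀ y : M, TangentSpace (𝓡 n) y, (∀ i, SmoothFieldOn (s i) U) ∧
      ∀ y ∈ U, LinearIndependent ℝ (fun i ↦ s i y) ∧ Submodule.span ℝ (range fun i ↦ s i y) = D y
  involutive : ∀ U : Set M, IsOpen U → ∀ X Y : ∀ y : M, TangentSpace (𝓡 n) y,
    SmoothFieldOn X U → SmoothFieldOn Y U → (∀ y ∈ U, X y ∈ D y) → (∀ y ∈ U, Y y ∈ D y) →
      ∀ y ∈ U, VectorField.mlieBracket (𝓡 n) X Y y ∈ D y

/-- Smooth Riemannian metrics on `M`. -/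
abbrev Metric (n : ℕ) (M : Type*) [TopologicalSpace M]
    [ChartedSpace (EuclideanSpace ℝ (Fin n)) M] [IsManifold (𝓡 n) ∞ M] :=
  ContMDiffRiemannianMetric (𝓡 n) ∞ (EuclideanSpace ℝ (Fin n))
    (fun x : M ↦ TangentSpace (𝓡 n) x)

/-- `cov` is the Levi-Civita connection of the metric `g`: it is torsion-free and
`X(g(Y, Z)) = g(∇_X Y, Z) + g(Y, ∇_X Z)`. The vector `(∇_X Y)(x)` is written `cov Y x (X x)`. -/
structure IsLeviCivita [IsManifold (𝓡 n) ∞ M] (g : Metric n M)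
    (cov : CovariantDerivative (𝓡 n) (EuclideanSpace ℝ (Fin n))
      (TangentSpace (𝓡 n) : M → Type _)) : Prop where
  torsion_eq_zero : cov.torsion = 0
  metric : ∀ (x : M) (v : TangentSpace (𝓡 n) x) (Y Z : ∀ y : M, TangentSpace (𝓡 n) y),
    MDifferentiableAt (𝓡 n) ((𝓡 n).prod 𝓘(ℝ, EuclideanSpace ℝ (Fin n)))
      (fun y ↦ TotalSpace.mk' (EuclideanSpace ℝ (Fin n)) y (Y y)) x →
    MDifferentiableAt (𝓡 n) ((𝓡 n).prod 𝓘(ℝ, EuclideanSpace ℝ (Fin n)))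
      (fun y ↦ TotalSpace.mk' (EuclideanSpace ℝ (Fin n)) y (Z y)) x →
    mfderiv (𝓡 n) 𝓘(ℝ, ℝ) (fun y ↦ g.inner y (Y y) (Z y)) x v =
      g.inner x (cov Y x v) (Z x) + g.inner x (Y x) (cov Z x v)

/-- The distribution `D` is tangent to a `p`-dimensional foliation all of whose leaves are minimal
submanifolds of `(M, g)`. For every local orthonormal frame `e₁, …, e_p` of `D`, the component of
`∑ ∇_{e_i} e_i` normal to `D` (the trace of the second fundamental form of the leaves, that is,
the mean curvature vector up to the factor `1 / p`) vanishes. -/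
structure IsMinimalFoliation [IsManifold (𝓡 n) ∞ M] (g : Metric n M)
    (D : ∀ x : M, Submodule ℝ (TangentSpace (𝓡 n) x)) (p : ℕ) : Prop where
  isFoliation : IsFoliation D p
  meanCurvature_eq_zero : ∃ cov : CovariantDerivative (𝓡 n) (EuclideanSpace ℝ (Fin n))
      (TangentSpace (𝓡 n) : M → Type _), IsLeviCivita g cov ∧
    ∀ U : Set M, IsOpen U → ∀ e : Fin p → ∀ y : M, TangentSpace (𝓡 n) y,
      (∀ i, SmoothFieldOn (e i) U) → (∀ i, ∀ y ∈ U, e i y ∈ D y) →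
      (∀ i j, ∀ y ∈ U, g.inner y (e i y) (e j y) = if i = j then 1 else 0) →
      ∀ x ∈ U, ∀ ν : TangentSpace (𝓡 n) x, (∀ w ∈ D x, g.inner x ν w = 0) →
        g.inner x (∑ i, cov (e i) x (e i x)) ν = 0

end Manifold

end ContactPair

end

/-! Write βᵢ for the bilinear form αᵢ ⊗ αᵢ + dαᵢ (`charBilin`). It is not symmetric, but its left
and right kernels are both TFᵢ, so it carries αᵢ and dαᵢ in one tensor.

A vector in TF₁ ∩ TF₂ annihilates every factor of the volume form, so the intersection is zero. The
condition (dα₁)^(h+1) = 0 bounds the rank of dα₁ by 2h, so TF₁ has codimension at most 2h+1, and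
likewise for TF₂ with 2k+1. These codimensions add up to dim M, so TM = TF₁ ⊕ TF₂ with the expected
ranks. The projections are smooth because they solve linear systems with the nondegenerate smooth
matrix of β₁ + β₂.

The key fact is `mfderiv_charBilin_apply`: if N is a section of TFᵢ, then L_N βᵢ = 0, because αᵢ(N)
= 0 and dαᵢ(N, ·) = 0. Applied to a section of TFᵢ itself it yields involutivity. Applied to β₂ on
TF₁ it yields minimality, as follows.

Since TF₂ is the kernel of β₂, the form β₂ is nondegenerate on TF₁. Start from any Riemannian
metric, make TF₁ and TF₂ orthogonal, and rescale it on TF₁ by a positive function so that the Gram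
matrix S of β₂ in each orthonormal frame (eᵢ) of TF₁ satisfies (det S)² = 1; do the same for β₁ on
TF₂. For N in TF₂ put Aᵢₖ = g([N, eᵢ], eₖ). Invariance gives N(S) = A S + S Aᵀ, so Jacobi's formula
gives 0 = N((det S)²) = 4 (det S)² tr A. As g([N, eᵢ], eᵢ) = g(N, ∇_{eᵢ} eᵢ), the vanishing of tr A
is the vanishing of the mean curvature of F₁ in the direction N.

This is Rummler's criterion in disguise: on TF₁, det S is up to a constant the square of α₂ ∧
(dα₂)^k on the frame. Working with determinants avoids orientations and volume forms of leaves. -/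

noncomputable section

namespace ContactPair

/-! ### Exterior algebra: rank of a 2-form from its wedge powers -/

section LinearAlgebra

open Equiv Module

variable {V : Type*} [AddCommGroup V] [Module ℝ V]

/-- The product `∏ θ(v₂ᵢ, v₂ᵢ₊₁)`, whose alternatization is a multiple of the wedge power. -/
def pairProd (θ : V [⋀^Fin 2]→ₗ[ℝ] ℝ) : (m : ℕ) → MultilinearMap ℝ (fun _ : Fin (2 * m) ↦ V) ℝ
  | 0 => MultilinearMap.constOfIsEmpty ℝ (fun _ : Fin 0 ↦ V) (1 : ℝ)
  | m + 1 => ((LinearMap.mul' ℝ ℝ).compMultilinearMap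
      ((pairProd θ m).domCoprod (θ : MultilinearMap ℝ (fun _ : Fin 2 ↦ V) ℝ))).domDomCongr
        (finSumFinEquiv : Fin (2 * m) ⊕ Fin 2 ≃ Fin (2 * m + 2))

theorem pairProd_apply (θ : V [⋀^Fin 2]→ₗ[ℝ] ℝ) (m : ℕ) (v : Fin (2 * m) → V) :
    pairProd θ m v =
      ∏ i : Fin m, θ ![v ⟨2 * i, by omega⟩, v ⟨2 * i + 1, by omega⟩] := by
  induction m with
  | zero => simp [pairProd]
  | succ m ih =>
    have h1 : pairProd θ (m + 1) v =
        pairProd θ m (fun i ↦ v (finSumFinEquiv (Sum.inl i))) *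
          θ (fun i ↦ v (finSumFinEquiv (Sum.inr i))) := rfl
    rw [h1, ih, Fin.prod_univ_castSucc]
    congr 2
    ext i
    fin_cases i <;> rfl

theorem alternatization_domDomCongr {ι ι' : Type*} [Fintype ι] [DecidableEq ι] [Fintype ι']
    [DecidableEq ι'] (e : ι ≃ ι') (f : MultilinearMap ℝ (fun _ : ι ↦ V) ℝ) :
    MultilinearMap.alternatization (f.domDomCongr e) =
      (MultilinearMap.alternatization f).domDomCongr e := by
  ext v
  simp only [AlternatingMap.domDomCongr_apply, MultilinearMap.alternatization_apply]
  rw [← Equiv.sum_comp e.permCongr]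
  refine Finset.sum_congr rfl fun σ _ ↦ ?_
  rw [Perm.sign_permCongr]
  congr 1
  simp only [MultilinearMap.domDomCongr_apply]
  congr 1
  ext i
  simp

/-- Alternatization turns a tensor product into the shuffle product of the alternatizations, and an
alternating 2-form alternatizes to 2! times itself; each factor thus contributes a 2. This replaces
the recursive wedge power by an explicit sum over permutations. -/
theorem alternatization_pairProd (θ : V [⋀^Fin 2]→ₗ[ℝ] ℝ) (m : ℕ) :
    MultilinearMap.alternatization (pairProd θ m) = (2 ^ m : ℝ) • wedgePow θ m := by
  induction m with
  | zero =>
    ext v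
    simp [pairProd, wedgePow, MultilinearMap.alternatization_apply]
  | succ m ih =>
    have h2 : MultilinearMap.alternatization (θ : MultilinearMap ℝ (fun _ : Fin 2 ↦ V) ℝ)
        = (2 : ℝ) • θ := by
      rw [AlternatingMap.coe_alternatization]
      ext v
      simp
    change MultilinearMap.alternatization (MultilinearMap.domDomCongr
      (finSumFinEquiv : Fin (2 * m) ⊕ Fin 2 ≃ Fin (2 * m + 2)) _) = _
    rw [alternatization_domDomCongr, LinearMap.compMultilinearMap_alternatization,
      MultilinearMap.domCoprod_alternization, ih, h2, ← AlternatingMap.domCoprod'_apply,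
      ← TensorProduct.smul_tmul', TensorProduct.tmul_smul, map_smul, map_smul]
    ext v
    simp only [wedgePow, wedge, AlternatingMap.domDomCongr_apply, AlternatingMap.smul_apply,
      LinearMap.compAlternatingMap_apply, map_smul, AlternatingMap.domCoprod'_apply]
    simp only [smul_eq_mul, pow_succ, mul_assoc]

/-- The standard symplectic form on a symplectic basis indexed by `ι × Fin 2`. -/
def stdPairing {ι : Type*} [DecidableEq ι] (a b : ι × Fin 2) : ℝ :=
  if a.1 = b.1 then ((b.2 : ℕ) : ℝ) - ((a.2 : ℕ) : ℝ) else 0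

/-- A nonzero product forces σ to carry pairs to pairs. Both its sign and the product then equal the
product of the signs of the permutations inside the pairs, so the term is a square. -/
theorem sign_mul_prod_stdPairing_nonneg {ι : Type*} [DecidableEq ι] [Fintype ι]
    (σ : Perm (ι × Fin 2)) :
    0 ≤ ((Perm.sign σ : ℤ) : ℝ) * ∏ i, stdPairing (σ (i, 0)) (σ (i, 1)) := by
  by_cases h0 : ∃ i, stdPairing (σ (i, 0)) (σ (i, 1)) = 0
  · obtain ⟨i, hi⟩ := h0
    rw [Finset.prod_eq_zero (Finset.mem_univ i) hi, mul_zero]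
  push Not at h0
  have h1 : ∀ i, (σ (i, 0)).1 = (σ (i, 1)).1 := fun i ↦ by
    by_contra h
    exact h0 i (if_neg h)
  have h2 : ∀ i b, (σ (i, b)).1 = (σ (i, 0)).1 := fun i b ↦ by
    fin_cases b
    · rfl
    · exact (h1 i).symm
  have hτ : ∀ i, Function.Injective fun b ↦ (σ (i, b)).2 := fun i b c hbc ↦ by
    have : σ (i, b) = σ (i, c) := Prod.ext ((h2 i b).trans (h2 i c).symm) hbc
    exact congrArg Prod.snd (σ.injective this)
  have hρ : Function.Injective fun i ↦ (σ (i, 0)).1 := fun i j hij ↦ by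
    obtain ⟨b, hb⟩ := (Finite.injective_iff_surjective.1 (hτ j)) (σ (i, 0)).2
    have : σ (j, b) = σ (i, 0) := Prod.ext ((h2 j b).trans hij.symm) hb
    exact (congrArg Prod.fst (σ.injective this)).symm
  let ρ : Perm ι := Equiv.ofBijective _ (Finite.injective_iff_bijective.1 hρ)
  let τ : ι → Perm (Fin 2) := fun i ↦ Equiv.ofBijective _ (Finite.injective_iff_bijective.1 (hτ i))
  have hσ : σ = Equiv.prodCongrLeft (fun _ : Fin 2 ↦ ρ) * Equiv.prodCongrRight τ := by
    ext1 ⟨i, b⟩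
    exact Prod.ext (h2 i b) rfl
  -- The block permutation ρ acts on both layers `ι × {0}` and `ι × {1}`, so it contributes the
  -- square of its sign.
  have hs : Perm.sign σ = ∏ i, Perm.sign (τ i) := by
    rw [hσ, Perm.sign_mul, Perm.sign_prodCongrLeft, Perm.sign_prodCongrRight]
    simp
  have hval : ∀ i, stdPairing (σ (i, 0)) (σ (i, 1)) = ((Perm.sign (τ i) : ℤ) : ℝ) := fun i ↦ by
    have e1 : stdPairing (σ (i, 0)) (σ (i, 1)) = ((τ i 1 : ℕ) : ℝ) - ((τ i 0 : ℕ) : ℝ) :=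
      if_pos (h1 i)
    rw [e1]
    generalize τ i = t
    clear * -
    revert t
    have : ∀ t : Perm (Fin 2), ((t 1 : ℕ) : ℤ) - ((t 0 : ℕ) : ℤ) = (Perm.sign t : ℤ) := by decide
    intro t
    exact_mod_cast this t
  simp only [hval, hs]
  push_cast
  rw [← sq]
  positivity

/-- A wedge power `θ ^ m` does not vanish as soon as there is a symplectic family of size `2 m`. -/
theorem wedgePow_ne_zero (θ : V [⋀^Fin 2]→ₗ[ℝ] ℝ) {m : ℕ} (u : Fin m × Fin 2 → V)
    (hu : ∀ a b, θ ![u a, u b] = stdPairing a b) : wedgePow θ m ≠ 0 := by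
  intro h
  have h0 := alternatization_pairProd θ m
  rw [h, smul_zero] at h0
  let E : Fin m × Fin 2 ≃ Fin (2 * m) :=
    finProdFinEquiv.trans (finCongr (Nat.mul_comm m 2))
  have hE0 : ∀ i : Fin m, E (i, 0) = ⟨2 * i, by omega⟩ := fun i ↦ by
    ext; simp [E]
  have hE1 : ∀ i : Fin m, E (i, 1) = ⟨2 * i + 1, by omega⟩ := fun i ↦ by
    ext; simp [E, add_comm]
  have h1 := congrArg (fun f ↦ f (u ∘ E.symm)) h0
  simp only [MultilinearMap.alternatization_apply, AlternatingMap.zero_apply] at h1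
  rw [← Equiv.sum_comp E.permCongr] at h1
  have h2 : ∀ σ : Perm (Fin m × Fin 2), Perm.sign (E.permCongr σ) •
      (MultilinearMap.domDomCongr (E.permCongr σ) (pairProd θ m)) (u ∘ E.symm) =
      ((Perm.sign σ : ℤ) : ℝ) * ∏ i, stdPairing (σ (i, 0)) (σ (i, 1)) := fun σ ↦ by
    rw [Perm.sign_permCongr, MultilinearMap.domDomCongr_apply, pairProd_apply, Units.smul_def,
      zsmul_eq_mul]
    congr 1
    refine Finset.prod_congr rfl fun i _ ↦ ?_
    rw [← hu, ← hE0, ← hE1]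
    simp
  simp only [h2] at h1
  -- No cancellation is possible: a vanishing sum of nonnegative terms would kill the identity term,
  -- which is 1.
  rw [Finset.sum_eq_zero_iff_of_nonneg fun σ _ ↦ sign_mul_prod_stdPairing_nonneg σ] at h1
  have := h1 1 (Finset.mem_univ _)
  simp [stdPairing] at this

theorem update_pair_one {W : Type*} (u v x : W) : Function.update ![u, v] 1 x = ![u, x] := by
  ext i; fin_cases i <;> rfl

/-- The number `θ(v, w)` as a bilinear form. -/
def formBilin (θ : V [⋀^Fin 2]→ₗ[ℝ] ℝ) : V →ₗ[ℝ] V →ₗ[ℝ] ℝ :=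
  LinearMap.mk₂ ℝ (fun v w ↦ θ ![v, w])
    (fun u v w ↦ θ.map_vecCons_add ![w] u v)
    (fun c v w ↦ θ.map_vecCons_smul ![w] c v)
    (fun u v w ↦ by
      have := θ.map_update_add ![u, v] 1 v w
      simpa only [update_pair_one] using this)
    (fun c u v ↦ by
      have := θ.map_update_smul ![u, v] 1 c v
      simpa only [update_pair_one] using this)

@[simp] theorem formBilin_apply (θ : V [⋀^Fin 2]→ₗ[ℝ] ℝ) (v w : V) :
    formBilin θ v w = θ ![v, w] := rfl

theorem form_self (θ : V [⋀^Fin 2]→ₗ[ℝ] ℝ) (v : V) : θ ![v, v] = 0 :=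
  θ.map_eq_zero_of_eq _ (i := 0) (j := 1) rfl (by simp)

theorem form_swap (θ : V [⋀^Fin 2]→ₗ[ℝ] ℝ) (v w : V) : θ ![v, w] = - θ ![w, v] := by
  have h := form_self θ (v + w)
  simp only [← formBilin_apply, map_add, LinearMap.add_apply] at h ⊢
  have h1 := form_self θ v
  have h2 := form_self θ w
  simp only [← formBilin_apply] at h1 h2
  linarith

/-- Either there is a symplectic family of size `2 (m + 1)`, or the kernel of the `2`-form contains
the common kernel of `2 m` linear forms. -/
theorem exists_symplectic_or (θ : V [⋀^Fin 2]→ₗ[ℝ] ℝ) (m : ℕ) :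
    (∃ u : Fin m × Fin 2 → V, ∀ a b, θ ![u a, u b] = stdPairing a b) ∨
      ∃ l < m, ∃ φ : Fin l × Fin 2 → V →ₗ[ℝ] ℝ, ∀ v, (∀ a, φ a v = 0) → ∀ w, θ ![v, w] = 0 := by
  induction m with
  | zero => exact Or.inl ⟨fun a ↦ a.1.elim0, fun a ↦ a.1.elim0⟩
  | succ m ih =>
    rcases ih with ⟨u, hu⟩ | ⟨l, hl, φ, hφ⟩
    swap
    · exact Or.inr ⟨l, by omega, φ, hφ⟩
    -- Let W be the θ-orthogonal of the family. If θ vanishes on W, then a vector of W is orthogonal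
    -- to W and to the family, which together span V (`w'` is the component of w in W). Otherwise
    -- two vectors of W, one of them rescaled, extend the family.
    by_cases hW : ∀ v w, (∀ a, θ ![u a, v] = 0) → (∀ a, θ ![u a, w] = 0) → θ ![v, w] = 0
    · right
      refine ⟨m, by omega, fun a ↦ formBilin θ (u a), fun v hv w ↦ ?_⟩
      simp only [formBilin_apply] at hv
      let w' : V := w - ∑ i, (θ ![u (i, 0), w] • u (i, 1) - θ ![u (i, 1), w] • u (i, 0))
      have hw' : ∀ a, θ ![u a, w'] = 0 := by
        rintro ⟨j, b⟩
        simp only [w', ← formBilin_apply, map_sub, map_sum, map_smul]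
        simp only [formBilin_apply, hu, stdPairing]
        fin_cases b <;> simp
      have h1 := hW v w' hv hw'
      simp only [w', ← formBilin_apply, map_sub, map_sum, map_smul] at h1
      simp only [formBilin_apply] at h1
      have h2 : ∀ a, θ ![v, u a] = 0 := fun a ↦ by rw [form_swap, hv, neg_zero]
      simpa [h2] using h1
    · left
      push Not at hW
      obtain ⟨v, w, hv, hw, hvw⟩ := hW
      have hw2 : ∀ a, θ ![w, u a] = 0 := fun a ↦ by rw [form_swap, hw, neg_zero]
      have hv2 : ∀ a, θ ![v, u a] = 0 := fun a ↦ by rw [form_swap, hv, neg_zero]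
      let c := (θ ![v, w])⁻¹
      let p : Fin 2 → V := ![v, c • w]
      have hp : ∀ b b', θ ![p b, p b'] = ((b' : ℕ) : ℝ) - ((b : ℕ) : ℝ) := by
        intro b b'
        have hwv := form_swap θ w v
        have hvw' := hvw
        simp only [← formBilin_apply] at hvw hwv ⊢
        have h1 := form_self θ v
        have h2 := form_self θ w
        simp only [← formBilin_apply] at h1 h2
        fin_cases b <;> fin_cases b' <;> simp only [p, c, Fin.zero_eta, Fin.mk_one,
          Matrix.cons_val_zero, Matrix.cons_val_one, map_smul, LinearMap.smul_apply, h1, h2, hwv,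
          smul_eq_mul, ← formBilin_apply, Fin.isValue] <;> simp [hvw']
      have hpu : ∀ b a, θ ![p b, u a] = 0 := by
        intro b a
        have h1 := hv2 a
        have h2 := hw2 a
        simp only [← formBilin_apply] at h1 h2 ⊢
        fin_cases b <;> simp only [p, Fin.zero_eta, Fin.mk_one,
          Matrix.cons_val_zero, Matrix.cons_val_one, map_smul, LinearMap.smul_apply, h1, h2,
          smul_zero, Fin.isValue]
      have hup : ∀ b a, θ ![u a, p b] = 0 := fun b a ↦ by rw [form_swap, hpu, neg_zero]
      refine ⟨fun a ↦ Fin.lastCases (motive := fun _ ↦ V) (p a.2) (fun i ↦ u (i, a.2)) a.1, ?_⟩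
      rintro ⟨i, b⟩ ⟨j, b'⟩
      induction i using Fin.lastCases with
      | last =>
        induction j using Fin.lastCases with
        | last => simp [hp, stdPairing]
        | cast j => simp [hpu, stdPairing, (Fin.castSucc_lt_last j).ne']
      | cast i =>
        induction j using Fin.lastCases with
        | last => simp [hup, stdPairing, (Fin.castSucc_lt_last i).ne]
        | cast j => simp [hu, stdPairing]

/-- In each shuffle the slot occupied by `v` goes to one of the two factors, which vanishes there.
Stating annihilation as "zero on every family having `v` as a member" makes the lemma iterate over
products. -/
theorem wedge_apply_eq_zero {a b : ℕ} (κ : V [⋀^Fin a]→ₗ[ℝ] ℝ) (η : V [⋀^Fin b]→ₗ[ℝ] ℝ) {v : V}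
    (hκ : ∀ u i, u i = v → κ u = 0) (hη : ∀ u i, u i = v → η u = 0) (u : Fin (a + b) → V)
    (i : Fin (a + b)) (hi : u i = v) : wedge κ η u = 0 := by
  simp only [wedge, AlternatingMap.domDomCongr_apply, LinearMap.compAlternatingMap_apply,
    AlternatingMap.domCoprod_apply, sum_apply, map_sum]
  refine Finset.sum_eq_zero fun σ _ ↦ ?_
  induction σ using Quotient.inductionOn' with
  | h σ =>
    rw [AlternatingMap.domCoprod.summand_mk'', smul_apply,
      MultilinearMap.domDomCongr_apply, MultilinearMap.domCoprod_apply]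
    rcases hj : σ.symm (finSumFinEquiv.symm i) with j | j
    · have : κ (fun i₁ ↦ u (finSumFinEquiv (σ (Sum.inl i₁)))) = 0 :=
        hκ _ j (by rw [← hj]; simpa using hi)
      simp [this]
    · have : η (fun i₁ ↦ u (finSumFinEquiv (σ (Sum.inr i₁)))) = 0 :=
        hη _ j (by rw [← hj]; simpa using hi)
      simp [this]

theorem wedgePow_apply_eq_zero (θ : V [⋀^Fin 2]→ₗ[ℝ] ℝ) {v : V} (hθ : ∀ w, θ ![v, w] = 0) (m : ℕ)
    (u : Fin (2 * m) → V) (i : Fin (2 * m)) (hi : u i = v) : wedgePow θ m u = 0 := by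
  induction m with
  | zero => exact i.elim0
  | succ m ih =>
    refine wedge_apply_eq_zero (wedgePow θ m) θ ih (fun u j hj ↦ ?_) u i hi
    have hu : u = ![u 0, u 1] := by ext i; fin_cases i <;> rfl
    rw [hu]
    fin_cases j
    · rw [show u 0 = v from hj, hθ]
    · rw [show u 1 = v from hj, form_swap, hθ, neg_zero]

theorem oneForm_apply_eq_zero (a : V →ₗ[ℝ] ℝ) {v : V} (hv : a v = 0) (u : Fin 1 → V) (i : Fin 1)
    (hi : u i = v) : oneForm a u = 0 := by
  rw [Subsingleton.elim i 0] at hi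
  simp [oneForm, hi, hv]

/-- A nonvanishing form of top degree vanishes on no family containing a nonzero vector. -/
theorem eq_zero_of_top_form {N : ℕ} [FiniteDimensional ℝ V] (hN : finrank ℝ V = N)
    (Ω : V [⋀^Fin N]→ₗ[ℝ] ℝ) (hΩ : Ω ≠ 0) {v : V} (hv : ∀ u i, u i = v → Ω u = 0) : v = 0 := by
  by_contra h
  have hli : LinearIndepOn ℝ id ({v} : Set V) :=
    LinearIndepOn.singleton (R := ℝ) (v := id) (i := v) h
  let b := Basis.extend hli
  have hmem : v ∈ hli.extend (subset_univ _) := hli.subset_extend _ rfl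
  have : Fintype (hli.extend (subset_univ ({v} : Set V))) :=
    FiniteDimensional.fintypeBasisIndex b
  have hcard : Fintype.card (hli.extend (subset_univ ({v} : Set V))) = Fintype.card (Fin N) := by
    rw [← finrank_eq_card_basis b, hN, Fintype.card_fin]
  let e := Fintype.equivOfCardEq hcard
  -- On a basis containing `v`, an injective choice of N basis vectors uses all of them, so `v`
  -- occurs.
  refine hΩ (Basis.ext_alternating (b.reindex e) fun w hw ↦ ?_)
  have hs : Function.Surjective w := Finite.injective_iff_surjective.1 hw
  obtain ⟨i, hi⟩ := hs (e ⟨v, hmem⟩)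
  rw [AlternatingMap.zero_apply]
  refine hv _ i ?_
  simp [hi, b]

theorem finrank_iInf_ker_ge [FiniteDimensional ℝ V] {ι : Type*} [Fintype ι]
    (φ : ι → V →ₗ[ℝ] ℝ) :
    finrank ℝ V ≤ finrank ℝ (LinearMap.ker (LinearMap.pi φ)) + Fintype.card ι := by
  have h := LinearMap.finrank_range_add_finrank_ker (LinearMap.pi φ)
  have h2 := Submodule.finrank_le (LinearMap.range (LinearMap.pi φ))
  rw [Module.finrank_fintype_fun_eq_card] at h2
  omega

/-- If `θ ^ (m + 1) = 0`, then `ker a ∩ ker θ` has codimension at most `2 m + 1`. -/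
theorem finrank_ge_of_wedgePow_eq_zero [FiniteDimensional ℝ V] (θ : V [⋀^Fin 2]→ₗ[ℝ] ℝ)
    (a : V →ₗ[ℝ] ℝ) {m : ℕ} (h : wedgePow θ (m + 1) = 0) (D : Submodule ℝ V)
    (hD : ∀ v, a v = 0 → (∀ w, θ ![v, w] = 0) → v ∈ D) :
    finrank ℝ V ≤ finrank ℝ D + (2 * m + 1) := by
  rcases exists_symplectic_or θ (m + 1) with ⟨u, hu⟩ | ⟨l, hl, φ, hφ⟩
  · exact absurd h (wedgePow_ne_zero θ u hu)
  -- The index `none` carries the equation `a = 0`; since `l < m + 1` there are 2l + 1 ≤ 2m + 1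
  -- equations.
  have h1 := finrank_iInf_ker_ge (fun o : Option (Fin l × Fin 2) ↦ o.elim a φ)
  have h2 : LinearMap.ker (LinearMap.pi fun o : Option (Fin l × Fin 2) ↦ o.elim a φ) ≤ D := by
    intro v hv
    have hv' : ∀ o : Option (Fin l × Fin 2), (o.elim a φ : V →ₗ[ℝ] ℝ) v = 0 :=
      fun o ↦ congrFun (LinearMap.mem_ker.1 hv) o
    exact hD v (hv' none) (hφ v fun x ↦ hv' (some x))
  have h3 := Submodule.finrank_mono h2
  simp only [Fintype.card_option, Fintype.card_prod, Fintype.card_fin] at h1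
  omega

end LinearAlgebra

/-! ### Vector fields, forms and exterior derivative in a fixed chart -/

section Charts

variable {n : ℕ} {M : Type*} [TopologicalSpace M] [ChartedSpace (EuclideanSpace ℝ (Fin n)) M]

theorem contMDiffAt_clm_of_apply {F G : Type*} [NormedAddCommGroup F] [NormedSpace ℝ F]
    [FiniteDimensional ℝ F] [NormedAddCommGroup G] [NormedSpace ℝ G] {f : M → F →L[ℝ] G} {x : M}
    (hf : ∀ u, ContMDiffAt (𝓡 n) 𝓘(ℝ, G) ∞ (fun y ↦ f y u) x) :
    ContMDiffAt (𝓡 n) 𝓘(ℝ, F →L[ℝ] G) ∞ f x := by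
  let b := Module.finBasis ℝ F
  have h : f = fun y ↦ ∑ i, (ContinuousLinearMap.smulRightL ℝ F G
      (LinearMap.toContinuousLinearMap (b.coord i))) (f y (b i)) := by
    ext y u
    conv_lhs => rw [← b.sum_repr u, map_sum]
    simp
  rw [h]
  refine contMDiffAt_finsetSum fun i _ ↦ ?_
  exact (ContinuousLinearMap.contMDiff _).contMDiffAt.comp x (hf (b i))

instance (x : M) : FiniteDimensional ℝ (TangentSpace (𝓡 n) x) :=
  inferInstanceAs (FiniteDimensional ℝ (EuclideanSpace ℝ (Fin n)))

instance (x : M) : T2Space (TangentSpace (𝓡 n) x) :=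
  inferInstanceAs (T2Space (EuclideanSpace ℝ (Fin n)))

/-- The bilinear form `α ⊗ α + dα`. -/
def charBilin (α : ∀ x : M, TangentSpace (𝓡 n) x →L[ℝ] ℝ) (x : M) :
    TangentSpace (𝓡 n) x →L[ℝ] TangentSpace (𝓡 n) x →L[ℝ] ℝ :=
  ((α x : TangentSpace (𝓡 n) x →ₗ[ℝ] ℝ).smulRight (α x : TangentSpace (𝓡 n) x →ₗ[ℝ] ℝ) +
    formBilin (extDerivOneForm α x).toAlternatingMap).toContinuousBilinearMap

theorem charBilin_apply (α : ∀ x : M, TangentSpace (𝓡 n) x →L[ℝ] ℝ) (x : M)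
    (v w : TangentSpace (𝓡 n) x) :
    charBilin α x v w = α x v * α x w + extDerivOneForm α x ![v, w] := rfl

variable [IsManifold (𝓡 n) ∞ M]

/-- The vector field is smooth at the point `x`. -/
def SmoothFieldAt (X : ∀ x : M, TangentSpace (𝓡 n) x) (x : M) : Prop :=
  ContMDiffAt (𝓡 n) ((𝓡 n).prod 𝓘(ℝ, EuclideanSpace ℝ (Fin n))) ∞
    (fun x ↦ TotalSpace.mk' (EuclideanSpace ℝ (Fin n)) x (X x)) x

/-- Coordinates on the tangent space at `y` in the chart at `x₀`. -/
def tcoord (x₀ y : M) : TangentSpace (𝓡 n) y →L[ℝ] EuclideanSpace ℝ (Fin n) :=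
  (trivializationAt (EuclideanSpace ℝ (Fin n)) (TangentSpace (𝓡 n)) x₀).continuousLinearMapAt ℝ y

/-- The vector field with constant coordinates `u` in the chart at `x₀`. -/
def constField (x₀ : M) (u : EuclideanSpace ℝ (Fin n)) (y : M) : TangentSpace (𝓡 n) y :=
  (trivializationAt (EuclideanSpace ℝ (Fin n)) (TangentSpace (𝓡 n)) x₀).symmL ℝ y u

theorem mem_baseSet {x₀ y : M} (hy : y ∈ (extChartAt (𝓡 n) x₀).source) :
    y ∈ (trivializationAt (EuclideanSpace ℝ (Fin n)) (TangentSpace (𝓡 n)) x₀).baseSet := by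
  rwa [extChartAt_source] at hy

theorem tcoord_constField {x₀ y : M} (hy : y ∈ (extChartAt (𝓡 n) x₀).source)
    (u : EuclideanSpace ℝ (Fin n)) : tcoord x₀ y (constField x₀ u y) = u :=
  Trivialization.continuousLinearMapAt_symmL _ (mem_baseSet hy) u

theorem constField_tcoord {x₀ y : M} (hy : y ∈ (extChartAt (𝓡 n) x₀).source)
    (v : TangentSpace (𝓡 n) y) : constField x₀ (tcoord x₀ y v) y = v :=
  Trivialization.symmL_continuousLinearMapAt _ (mem_baseSet hy) v

theorem tcoord_eq_mfderiv {x₀ y : M} (hy : y ∈ (extChartAt (𝓡 n) x₀).source) :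
    tcoord x₀ y = mfderiv (𝓡 n) 𝓘(ℝ, EuclideanSpace ℝ (Fin n)) (extChartAt (𝓡 n) x₀) y :=
  TangentBundle.continuousLinearMapAt_trivializationAt (by rwa [extChartAt_source] at hy)

theorem constField_eq_mfderiv {x₀ y : M} (hy : y ∈ (extChartAt (𝓡 n) x₀).source)
    (u : EuclideanSpace ℝ (Fin n)) : constField x₀ u y =
      mfderiv 𝓘(ℝ, EuclideanSpace ℝ (Fin n)) (𝓡 n) (extChartAt (𝓡 n) x₀).symm
        (extChartAt (𝓡 n) x₀ y) u := by
  have h := TangentBundle.symmL_trivializationAt (I := 𝓡 n) (x₀ := x₀) (x := y)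
    (by rwa [extChartAt_source] at hy)
  rw [ModelWithCorners.range_eq_univ, mfderivWithin_univ] at h
  exact congrArg (fun f ↦ f u) h

theorem smoothFieldAt_iff {x₀ y : M} (hy : y ∈ (extChartAt (𝓡 n) x₀).source)
    (X : ∀ x : M, TangentSpace (𝓡 n) x) : SmoothFieldAt X y ↔
      ContMDiffAt (𝓡 n) 𝓘(ℝ, EuclideanSpace ℝ (Fin n)) ∞ (fun x ↦ tcoord x₀ x (X x)) y := by
  refine ((trivializationAt (EuclideanSpace ℝ (Fin n)) (TangentSpace (𝓡 n))
    x₀).contMDiffAt_section_iff (mem_baseSet hy)).trans (Filter.EventuallyEq.contMDiffAt_iff ?_)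
  filter_upwards [(isOpen_extChartAt_source x₀).mem_nhds hy] with z hz
  exact (Trivialization.continuousLinearMapAt_apply_of_mem ℝ _ (mem_baseSet hz) _).symm

theorem smoothFieldAt_constField {x₀ y : M} (hy : y ∈ (extChartAt (𝓡 n) x₀).source)
    (u : EuclideanSpace ℝ (Fin n)) : SmoothFieldAt (constField x₀ u) y := by
  rw [smoothFieldAt_iff hy]
  refine contMDiffAt_const (c := u) |>.congr_of_eventuallyEq ?_
  filter_upwards [(isOpen_extChartAt_source x₀).mem_nhds hy] with z hz
  exact tcoord_constField hz u

theorem SmoothFieldOn.smoothFieldAt {X : ∀ x : M, TangentSpace (𝓡 n) x} {U : Set M}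
    (hX : SmoothFieldOn X U) (hU : IsOpen U) {x : M} (hx : x ∈ U) : SmoothFieldAt X x :=
  (hX x hx).contMDiffAt (hU.mem_nhds hx)

theorem IsSmoothOneForm.apply {α : ∀ x : M, TangentSpace (𝓡 n) x →L[ℝ] ℝ}
    (hα : IsSmoothOneForm α) {X : ∀ x : M, TangentSpace (𝓡 n) x} {x : M}
    (hX : SmoothFieldAt X x) : ContMDiffAt (𝓡 n) 𝓘(ℝ, ℝ) ∞ (fun y ↦ α y (X y)) x := by
  have h := ContMDiffAt.clm_bundle_apply (E₂ := Bundle.Trivial M ℝ) (F₂ := ℝ)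
    (b := fun y : M ↦ y) (ϕ := α) (v := X) (hα x) hX
  rw [contMDiffAt_totalSpace] at h
  exact h.2

/-- The bilinear form field is smooth, as a section of the bundle of bilinear forms. -/
def SmoothBilinAt (b : ∀ x : M, TangentSpace (𝓡 n) x →L[ℝ] TangentSpace (𝓡 n) x →L[ℝ] ℝ)
    (x : M) : Prop :=
  ContMDiffAt (𝓡 n) ((𝓡 n).prod
    𝓘(ℝ, EuclideanSpace ℝ (Fin n) →L[ℝ] EuclideanSpace ℝ (Fin n) →L[ℝ] ℝ)) ∞
    (fun x ↦ TotalSpace.mk' (EuclideanSpace ℝ (Fin n) →L[ℝ] EuclideanSpace ℝ (Fin n) →L[ℝ] ℝ)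
      x (b x)) x

theorem SmoothBilinAt.apply {b : ∀ x : M, TangentSpace (𝓡 n) x →L[ℝ] TangentSpace (𝓡 n) x →L[ℝ] ℝ}
    {x : M} (hb : SmoothBilinAt b x) {X Y : ∀ x : M, TangentSpace (𝓡 n) x}
    (hX : SmoothFieldAt X x) (hY : SmoothFieldAt Y x) :
    ContMDiffAt (𝓡 n) 𝓘(ℝ, ℝ) ∞ (fun y ↦ b y (X y) (Y y)) x := by
  have h := ContMDiffAt.clm_bundle_apply₂ (E₃ := Bundle.Trivial M ℝ) (F₃ := ℝ)
    (F₁ := EuclideanSpace ℝ (Fin n)) (F₂ := EuclideanSpace ℝ (Fin n))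
    (b := fun y : M ↦ y) (ψ := b) (v := X) (w := Y) hb hX hY
  rw [contMDiffAt_totalSpace] at h
  exact h.2

/-- The coordinate fields trivialize the bundle near `x`, so only the matrix entries have to be
smooth. -/
theorem smoothBilinAt_of_constField
    {b : ∀ x : M, TangentSpace (𝓡 n) x →L[ℝ] TangentSpace (𝓡 n) x →L[ℝ] ℝ} {x : M}
    (hb : ∀ u v, ContMDiffAt (𝓡 n) 𝓘(ℝ, ℝ) ∞
      (fun z ↦ b z (constField x u z) (constField x v z)) x) : SmoothBilinAt b x := by
  refine (Bundle.contMDiffAt_section x).2 ?_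
  refine contMDiffAt_clm_of_apply fun u ↦ contMDiffAt_clm_of_apply fun v ↦
    (hb u v).congr_of_eventuallyEq ?_
  filter_upwards [(isOpen_extChartAt_source x).mem_nhds (mem_extChartAt_source (I := 𝓡 n) x)]
    with z hz
  have h := inCoordinates_apply_eq₂ (𝕜 := ℝ) (E₁ := fun x : M ↦ TangentSpace (𝓡 n) x)
    (E₂ := fun x : M ↦ TangentSpace (𝓡 n) x) (E₃ := Bundle.Trivial M ℝ)
    (F₁ := EuclideanSpace ℝ (Fin n)) (F₂ := EuclideanSpace ℝ (Fin n)) (F₃ := ℝ)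
    (ϕ := b z) (v := u) (w := v) (x₀ := x) (mem_baseSet hz) (mem_baseSet hz) (mem_univ _)
  refine Eq.trans ?_ (h.trans ?_)
  · rfl
  · have hs : ∀ u, (trivializationAt (EuclideanSpace ℝ (Fin n))
        (fun x : M ↦ TangentSpace (𝓡 n) x) x).symm z u = constField x u z :=
      fun u ↦ (Trivialization.symmL_apply (R := ℝ) _ (mem_baseSet hz) u).symm
    rw [hs, hs]
    simp

theorem inChart_apply {α : ∀ x : M, TangentSpace (𝓡 n) x →L[ℝ] ℝ} {x₀ : M}
    {z : EuclideanSpace ℝ (Fin n)} (hz : z ∈ (extChartAt (𝓡 n) x₀).target)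
    (u : EuclideanSpace ℝ (Fin n)) :
    inChart α x₀ z u = α ((extChartAt (𝓡 n) x₀).symm z)
      (constField x₀ u ((extChartAt (𝓡 n) x₀).symm z)) := by
  rw [constField_eq_mfderiv ((extChartAt (𝓡 n) x₀).map_target hz), PartialEquiv.right_inv _ hz]
  rfl

theorem inChart_tcoord {α : ∀ x : M, TangentSpace (𝓡 n) x →L[ℝ] ℝ} {x₀ y : M}
    (hy : y ∈ (extChartAt (𝓡 n) x₀).source) (v : TangentSpace (𝓡 n) y) :
    inChart α x₀ (extChartAt (𝓡 n) x₀ y) (tcoord x₀ y v) = α y v := by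
  rw [inChart_apply ((extChartAt (𝓡 n) x₀).map_source hy), PartialEquiv.left_inv _ hy,
    constField_tcoord hy]

theorem contDiffAt_comp_symm {F : Type*} [NormedAddCommGroup F] [NormedSpace ℝ F] {f : M → F}
    {x₀ : M} {z : EuclideanSpace ℝ (Fin n)} (hz : z ∈ (extChartAt (𝓡 n) x₀).target)
    (hf : ContMDiffAt (𝓡 n) 𝓘(ℝ, F) ∞ f ((extChartAt (𝓡 n) x₀).symm z)) :
    ContDiffAt ℝ ∞ (fun z ↦ f ((extChartAt (𝓡 n) x₀).symm z)) z := by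
  rw [← contMDiffAt_iff_contDiffAt]
  exact hf.comp z ((contMDiffOn_extChartAt_symm x₀).contMDiffAt
    ((isOpen_extChartAt_target x₀).mem_nhds hz))

theorem contDiffAt_inChart {α : ∀ x : M, TangentSpace (𝓡 n) x →L[ℝ] ℝ} (hα : IsSmoothOneForm α)
    {x₀ : M} {z : EuclideanSpace ℝ (Fin n)} (hz : z ∈ (extChartAt (𝓡 n) x₀).target) :
    ContDiffAt ℝ ∞ (inChart α x₀) z := by
  rw [← contMDiffAt_iff_contDiffAt]
  refine contMDiffAt_clm_of_apply fun u ↦ contMDiffAt_iff_contDiffAt.2 ?_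
  have h := contDiffAt_comp_symm hz
    (hα.apply (smoothFieldAt_constField ((extChartAt (𝓡 n) x₀).map_target hz) u))
  refine h.congr_of_eventuallyEq ?_
  filter_upwards [(isOpen_extChartAt_target x₀).mem_nhds hz] with w hw
  exact inChart_apply hw u

theorem extDeriv_ofSubsingleton {E : Type*} [NormedAddCommGroup E] [NormedSpace ℝ E]
    {a : E → E →L[ℝ] ℝ} {z : E} (ha : DifferentiableAt ℝ a z) (u v : E) :
    extDeriv (fun y ↦ ContinuousAlternatingMap.ofSubsingleton ℝ E ℝ (0 : Fin 1) (a y)) z ![u, v] =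
      fderiv ℝ a z u v - fderiv ℝ a z v u := by
  have h : DifferentiableAt ℝ
      (fun y ↦ ContinuousAlternatingMap.ofSubsingleton ℝ E ℝ (0 : Fin 1) (a y)) z :=
    ((ContinuousAlternatingMap.ofSubsingletonLIE (𝕜 := ℝ) (E := E) (F := ℝ)
      (0 : Fin 1)).toContinuousLinearEquiv.differentiable).differentiableAt.comp z ha
  rw [extDeriv_apply h, Fin.sum_univ_two]
  have h1 : ∀ w x : E, fderiv ℝ (fun y ↦ a y w) z x = fderiv ℝ a z x w := fun w x ↦ by
    rw [fderiv_clm_apply ha (differentiableAt_const w)]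
    simp
  simp [Fin.removeNth, h1, sub_eq_add_neg]

/-- The coordinate expression `a ⊗ a + da` of `charBilin`. -/
def flatBilin {E : Type*} [NormedAddCommGroup E] [NormedSpace ℝ E] (a : E → E →L[ℝ] ℝ)
    (z u v : E) : ℝ :=
  a z u * a z v + (fderiv ℝ a z u v - fderiv ℝ a z v u)

/-- The tangent space at `x` is by construction read in the preferred chart at `x`, so that chart
has identity derivative at its own base point. -/
theorem constField_self (x : M) (u : EuclideanSpace ℝ (Fin n)) : constField x u x = u := by
  rw [constField_eq_mfderiv (mem_extChartAt_source x)]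
  have h := mfderivWithin_range_extChartAt_symm (I := 𝓡 n) (x := x)
  rw [ModelWithCorners.range_eq_univ, mfderivWithin_univ] at h
  rw [h]
  rfl

theorem tcoord_self (x : M) (v : TangentSpace (𝓡 n) x) : tcoord x x v = v := by
  rw [tcoord_eq_mfderiv (mem_extChartAt_source x), mfderiv_extChartAt_self]
  rfl

/-- The definition of dα at y uses the chart at y, which jumps with y. Near y the two coordinate
expressions of α are related by pullback under the transition map τ, and d commutes with pullback;
hence one fixed chart computes dα throughout its domain. -/
theorem extDerivOneForm_eq {α : ∀ x : M, TangentSpace (𝓡 n) x →L[ℝ] ℝ} (hα : IsSmoothOneForm α)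
    {x₀ y : M} (hy : y ∈ (extChartAt (𝓡 n) x₀).source) (v w : TangentSpace (𝓡 n) y) :
    extDerivOneForm α y ![v, w] =
      fderiv ℝ (inChart α x₀) (extChartAt (𝓡 n) x₀ y) (tcoord x₀ y v) (tcoord x₀ y w) -
      fderiv ℝ (inChart α x₀) (extChartAt (𝓡 n) x₀ y) (tcoord x₀ y w) (tcoord x₀ y v) := by
  let e := extChartAt (𝓡 n) y
  let e₀ := extChartAt (𝓡 n) x₀
  let τ : EuclideanSpace ℝ (Fin n) → EuclideanSpace ℝ (Fin n) := e₀ ∘ e.symm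
  let A : EuclideanSpace ℝ (Fin n) → EuclideanSpace ℝ (Fin n) [⋀^Fin 1]→L[ℝ] ℝ := fun z ↦
    ContinuousAlternatingMap.ofSubsingleton ℝ (EuclideanSpace ℝ (Fin n)) ℝ (0 : Fin 1)
      (inChart α x₀ z)
  have hsymm : ∀ z ∈ e.target, MDifferentiableAt 𝓘(ℝ, EuclideanSpace ℝ (Fin n)) (𝓡 n) e.symm z :=
    fun z hz ↦ ((contMDiffOn_extChartAt_symm (n := ∞) y).contMDiffAt
      ((isOpen_extChartAt_target y).mem_nhds hz)).mdifferentiableAt (by simp)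
  have hτd : ∀ z ∈ e.target, e.symm z ∈ e₀.source → ∀ u,
      fderiv ℝ τ z u = tcoord x₀ (e.symm z) (constField y u (e.symm z)) := fun z hz hz₀ u ↦ by
    rw [constField_eq_mfderiv (e.map_target hz), e.right_inv hz, tcoord_eq_mfderiv hz₀,
      ← mfderiv_eq_fderiv, mfderiv_comp z (mdifferentiableAt_extChartAt
        (by rwa [extChartAt_source] at hz₀)) (hsymm z hz)]
    rfl
  have hyt : e y ∈ e.target := mem_extChartAt_target y
  have hye : e.symm (e y) = y := extChartAt_to_inv y
  have hnhds : ∀ᶠ z in 𝓝 (e y), z ∈ e.target ∧ e.symm z ∈ e₀.source := by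
    refine Filter.Eventually.and ((isOpen_extChartAt_target y).mem_nhds hyt) ?_
    refine (hsymm _ hyt).continuousAt.eventually ?_
    rw [hye]
    exact (isOpen_extChartAt_source x₀).mem_nhds hy
  have hev : (fun z ↦ ContinuousAlternatingMap.ofSubsingleton ℝ (EuclideanSpace ℝ (Fin n)) ℝ
      (0 : Fin 1) (inChart α y z)) =ᶠ[𝓝 (e y)]
      fun z ↦ (A (τ z)).compContinuousLinearMap (fderiv ℝ τ z) := by
    filter_upwards [hnhds] with z ⟨hz, hz₀⟩
    ext u
    have h1 : inChart α y z (u 0) = inChart α x₀ (τ z) (fderiv ℝ τ z (u 0)) := by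
      rw [hτd z hz hz₀, inChart_apply hz]
      exact (inChart_tcoord hz₀ _).symm
    exact h1
  have hτy : τ (e y) = e₀ y := congrArg e₀ hye
  have ha : ContDiffAt ℝ ∞ (inChart α x₀) (e₀ y) := contDiffAt_inChart hα (e₀.map_source hy)
  have hA : DifferentiableAt ℝ A (τ (e y)) := by
    rw [hτy]
    exact ((ContinuousAlternatingMap.ofSubsingletonLIE (𝕜 := ℝ)
      (E := EuclideanSpace ℝ (Fin n)) (F := ℝ)
      (0 : Fin 1)).toContinuousLinearEquiv.differentiable).differentiableAt.comp _
        (ha.differentiableAt (by simp))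
  have hτs : ContDiffAt ℝ ∞ τ (e y) := contDiffAt_comp_symm hyt (by
    change ContMDiffAt _ _ _ _ (e.symm (e y))
    rw [hye]
    exact contMDiffAt_extChartAt' (by rwa [extChartAt_source] at hy))
  have hd := (hev.extDeriv_eq).trans (extDeriv_pullback hA hτs (by
    rw [minSmoothness_of_isRCLikeNormedField]; exact ENat.LEInfty.out))
  have hu : ∀ u : EuclideanSpace ℝ (Fin n), fderiv ℝ τ (e y) u = tcoord x₀ y u := fun u ↦ by
    have h1 : ∀ p : M, p = y →
        tcoord x₀ p (constField y u p) = tcoord x₀ y (constField y u y) := by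
      rintro p rfl
      rfl
    rw [hτd _ hyt (by rwa [hye]), h1 _ hye, constField_self]
  have h2 : extDerivOneForm α y ![v, w] =
      extDeriv A (e₀ y) ![fderiv ℝ τ (e y) v, fderiv ℝ τ (e y) w] := by
    unfold extDerivOneForm
    rw [mfderiv_extChartAt_self, ← hτy]
    have h3 := congrArg (fun f ↦ f (![v, w] : Fin 2 → EuclideanSpace ℝ (Fin n))) hd
    refine Eq.trans ?_ (h3.trans ?_)
    · rfl
    · refine congrArg (extDeriv A (τ (e y))) ?_
      ext i : 1
      fin_cases i <;> rfl
  rw [h2, extDeriv_ofSubsingleton (ha.differentiableAt (by simp))]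
  exact congrArg₂ (fun a b : EuclideanSpace ℝ (Fin n) ↦ fderiv ℝ (inChart α x₀) (e₀ y) a b -
    fderiv ℝ (inChart α x₀) (e₀ y) b a) (hu v) (hu w)

theorem charBilin_eq {α : ∀ x : M, TangentSpace (𝓡 n) x →L[ℝ] ℝ} (hα : IsSmoothOneForm α)
    {x₀ y : M} (hy : y ∈ (extChartAt (𝓡 n) x₀).source) (v w : TangentSpace (𝓡 n) y) :
    charBilin α y v w =
      flatBilin (inChart α x₀) (extChartAt (𝓡 n) x₀ y) (tcoord x₀ y v) (tcoord x₀ y w) := by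
  rw [charBilin_apply, flatBilin, extDerivOneForm_eq hα hy, inChart_tcoord hy,
    inChart_tcoord hy]

theorem contDiffAt_flatBilin {E : Type*} [NormedAddCommGroup E] [NormedSpace ℝ E]
    {a : E → E →L[ℝ] ℝ} {z : E} (ha : ContDiffAt ℝ ∞ a z) (u v : E) :
    ContDiffAt ℝ ∞ (fun z ↦ flatBilin a z u v) z := by
  have h : ContDiffAt ℝ ∞ (fderiv ℝ a) z := ha.fderiv_right (by simp)
  unfold flatBilin
  exact ((ha.clm_apply contDiffAt_const).mul (ha.clm_apply contDiffAt_const)).add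
    (((h.clm_apply contDiffAt_const).clm_apply contDiffAt_const).sub
      ((h.clm_apply contDiffAt_const).clm_apply contDiffAt_const))

theorem smoothBilinAt_charBilin {α : ∀ x : M, TangentSpace (𝓡 n) x →L[ℝ] ℝ}
    (hα : IsSmoothOneForm α) (x : M) : SmoothBilinAt (charBilin α) x := by
  refine smoothBilinAt_of_constField fun u v ↦ ?_
  have h1 : ContMDiffAt 𝓘(ℝ, EuclideanSpace ℝ (Fin n)) 𝓘(ℝ, ℝ) ∞
      (fun z ↦ flatBilin (inChart α x) z u v) (extChartAt (𝓡 n) x x) :=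
    contMDiffAt_iff_contDiffAt.2 (contDiffAt_flatBilin (contDiffAt_inChart hα
      (mem_extChartAt_target x)) u v)
  refine (h1.comp x contMDiffAt_extChartAt).congr_of_eventuallyEq ?_
  filter_upwards [(isOpen_extChartAt_source x).mem_nhds (mem_extChartAt_source (I := 𝓡 n) x)]
    with z hz
  rw [charBilin_eq hα hz, tcoord_constField hz, tcoord_constField hz]
  rfl

end Charts

/-! ### Invariance of α ⊗ α + dα along its kernel -/

section Calculus

set_option synthInstance.maxHeartbeats 400000 in
set_option maxHeartbeats 1000000 in
/-- The Lie derivative of `a ⊗ a + da` vanishes along a vector field in the kernel of `a` and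
`da`. -/
theorem fderiv_flatBilin_apply {E : Type*} [NormedAddCommGroup E] [NormedSpace ℝ E]
    {a : E → E →L[ℝ] ℝ} {z : E} (ha : ContDiffAt ℝ ∞ a z) {N X Y : E → E}
    (hN : DifferentiableAt ℝ N z) (hX : DifferentiableAt ℝ X z) (hY : DifferentiableAt ℝ Y z)
    (h1 : ∀ᶠ y in 𝓝 z, a y (N y) = 0)
    (h2 : ∀ᶠ y in 𝓝 z, ∀ w, fderiv ℝ a y (N y) w - fderiv ℝ a y w (N y) = 0) :
    fderiv ℝ (fun y ↦ flatBilin a y (X y) (Y y)) z (N z) =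
      flatBilin a z (VectorField.lieBracket ℝ N X z) (Y z) +
        flatBilin a z (X z) (VectorField.lieBracket ℝ N Y z) := by
  have hA : HasFDerivAt a (fderiv ℝ a z) z := (ha.differentiableAt (by simp)).hasFDerivAt
  have hA' : HasFDerivAt (fderiv ℝ a) (fderiv ℝ (fderiv ℝ a) z) z :=
    ((ha.fderiv_right (m := ∞) (by simp)).differentiableAt (by simp)).hasFDerivAt
  have hsymm : ∀ u v, fderiv ℝ (fderiv ℝ a) z u v = fderiv ℝ (fderiv ℝ a) z v u :=
    (ha.isSymmSndFDerivAt (by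
      rw [minSmoothness_of_isRCLikeNormedField]; exact ENat.LEInfty.out)).eq
  have aX := hA.clm_apply hX.hasFDerivAt
  have aY := hA.clm_apply hY.hasFDerivAt
  have aN := hA.clm_apply hN.hasFDerivAt
  have AXY := (hA'.clm_apply hX.hasFDerivAt).clm_apply hY.hasFDerivAt
  have AYX := (hA'.clm_apply hY.hasFDerivAt).clm_apply hX.hasFDerivAt
  have hD : HasFDerivAt (fun y ↦ flatBilin a y (X y) (Y y)) _ z :=
    (aX.mul aY).add (AXY.sub AYX)
  -- `e1` and `e2` differentiate the identities a(N) = 0 and da(N, w) = 0, the latter for a constant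
  -- w.
  have e1 : ∀ u, a z (fderiv ℝ N z u) + fderiv ℝ a z u (N z) = 0 := fun u ↦ by
    have h := (aN.congr_of_eventuallyEq (f₁ := fun _ ↦ (0 : ℝ))
      (h1.mono fun y hy ↦ hy.symm)).unique (hasFDerivAt_const (0 : ℝ) z)
    simpa using congrArg (fun f ↦ f u) h
  have e2 : ∀ w u, fderiv ℝ (fderiv ℝ a) z u (N z) w + fderiv ℝ a z (fderiv ℝ N z u) w -
      (fderiv ℝ (fderiv ℝ a) z u w (N z) + fderiv ℝ a z w (fderiv ℝ N z u)) = 0 := fun w u ↦ by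
    have hNw := ((hA'.clm_apply hN.hasFDerivAt).clm_apply (hasFDerivAt_const w z)).sub
      ((hA'.clm_apply (hasFDerivAt_const w z)).clm_apply hN.hasFDerivAt)
    have h := (hNw.congr_of_eventuallyEq (f₁ := fun _ ↦ (0 : ℝ))
      (h2.mono fun y hy ↦ (hy w).symm)).unique (hasFDerivAt_const (0 : ℝ) z)
    have h3 := congrArg (fun f ↦ f u) h
    simp at h3
    linear_combination h3
  have e3 := h2.self_of_nhds
  rw [hD.fderiv]
  simp only [flatBilin, VectorField.lieBracket_eq, map_sub, add_apply,
    sub_apply, smul_apply, ContinuousLinearMap.comp_apply,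
    ContinuousLinearMap.flip_apply, smul_eq_mul]
  -- Symmetry of the second derivative of a encodes d(da) = 0; combined with `e1`, `e2` and `e3` it
  -- is Cartan's formula written out.
  have s1 := congrArg (fun f ↦ f (Y z)) (hsymm (N z) (X z))
  have s2 := congrArg (fun f ↦ f (X z)) (hsymm (N z) (Y z))
  have s3 := congrArg (fun f ↦ f (N z)) (hsymm (X z) (Y z))
  linear_combination s1 - s2 + s3 + e2 (Y z) (X z) - e2 (X z) (Y z) + e3 (X z) * a z (Y z) +
    a z (X z) * e3 (Y z) + e1 (X z) * a z (Y z) + a z (X z) * e1 (Y z)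

variable {n : ℕ} {M : Type*} [TopologicalSpace M] [ChartedSpace (EuclideanSpace ℝ (Fin n)) M]

theorem mfderiv_eq_fderiv_chart {F : Type*} [NormedAddCommGroup F] [NormedSpace ℝ F] {f : M → F}
    {x : M} (hf : MDifferentiableAt (𝓡 n) 𝓘(ℝ, F) f x) (v : TangentSpace (𝓡 n) x) :
    mfderiv (𝓡 n) 𝓘(ℝ, F) f x v =
      fderiv ℝ (fun z ↦ f ((extChartAt (𝓡 n) x).symm z)) (extChartAt (𝓡 n) x x) v := by
  rw [hf.mfderiv, ModelWithCorners.range_eq_univ, fderivWithin_univ]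
  rfl

variable [IsManifold (𝓡 n) ∞ M]

/-- The coordinate expression of a vector field in the chart at `x`. -/
def fieldInChart (X : ∀ x : M, TangentSpace (𝓡 n) x) (x : M) (z : EuclideanSpace ℝ (Fin n)) :
    EuclideanSpace ℝ (Fin n) :=
  tcoord x ((extChartAt (𝓡 n) x).symm z) (X ((extChartAt (𝓡 n) x).symm z))

theorem fieldInChart_self (X : ∀ x : M, TangentSpace (𝓡 n) x) (x : M) :
    fieldInChart X x (extChartAt (𝓡 n) x x) = X x := by
  have h1 : ∀ p : M, p = x → tcoord x p (X p) = tcoord x x (X x) := by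
    rintro p rfl
    rfl
  rw [fieldInChart, h1 _ (extChartAt_to_inv x)]
  exact tcoord_self x (X x)

theorem mpullbackWithin_eq_fieldInChart (X : ∀ x : M, TangentSpace (𝓡 n) x) (x : M)
    {z : EuclideanSpace ℝ (Fin n)} (hz : z ∈ (extChartAt (𝓡 n) x).target) :
    VectorField.mpullbackWithin 𝓘(ℝ, EuclideanSpace ℝ (Fin n)) (𝓡 n) (extChartAt (𝓡 n) x).symm X
      (range (𝓡 n)) z = fieldInChart X x z := by
  rw [VectorField.mpullbackWithin_apply, fieldInChart,
    tcoord_eq_mfderiv ((extChartAt (𝓡 n) x).map_target hz)]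
  congr 1
  exact ContinuousLinearMap.inverse_eq
    (mfderivWithin_extChartAt_symm_comp_mfderiv_extChartAt hz)
    (mfderiv_extChartAt_comp_mfderivWithin_extChartAt_symm hz)

theorem SmoothFieldAt.contDiffAt_fieldInChart {X : ∀ x : M, TangentSpace (𝓡 n) x} {x : M}
    (hX : SmoothFieldAt X x) : ContDiffAt ℝ ∞ (fieldInChart X x) (extChartAt (𝓡 n) x x) := by
  refine contDiffAt_comp_symm (f := fun y ↦ tcoord x y (X y)) (mem_extChartAt_target x) ?_
  rw [extChartAt_to_inv]
  exact (smoothFieldAt_iff (mem_extChartAt_source x) X).1 hX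

theorem mlieBracket_eq_lieBracket (X Y : ∀ x : M, TangentSpace (𝓡 n) x) (x : M) :
    VectorField.mlieBracket (𝓡 n) X Y x = VectorField.lieBracket ℝ (fieldInChart X x)
      (fieldInChart Y x) (extChartAt (𝓡 n) x x) := by
  have h0 : ∀ w : EuclideanSpace ℝ (Fin n), (mfderiv (𝓡 n) 𝓘(ℝ, EuclideanSpace ℝ (Fin n))
      (extChartAt (𝓡 n) x) x).inverse w = w := fun w ↦ by
    rw [mfderiv_extChartAt_self]
    exact congrArg (fun f ↦ f w)
      (ContinuousLinearMap.inverse_id (R := ℝ) (M := EuclideanSpace ℝ (Fin n)))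
  rw [← VectorField.mlieBracketWithin_univ, VectorField.mlieBracketWithin_apply]
  refine (h0 _).trans ?_
  simp only [preimage_univ, univ_inter]
  have h : ∀ X : ∀ x : M, TangentSpace (𝓡 n) x,
      VectorField.mpullbackWithin 𝓘(ℝ, EuclideanSpace ℝ (Fin n)) (𝓡 n) (extChartAt (𝓡 n) x).symm X
      (range (𝓡 n)) =ᶠ[𝓝 (extChartAt (𝓡 n) x x)] fieldInChart X x := fun X ↦ by
    filter_upwards [(isOpen_extChartAt_target x).mem_nhds (mem_extChartAt_target (I := 𝓡 n) x)]
      with z hz using mpullbackWithin_eq_fieldInChart X x hz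
  rw [ModelWithCorners.range_eq_univ] at h ⊢
  refine (congrFun (VectorField.lieBracketWithin_univ (𝕜 := ℝ)
    (E := EuclideanSpace ℝ (Fin n))) _).trans ?_
  exact (h X).lieBracket_vectorField_eq (h Y)

/-- The Lie derivative of `α ⊗ α + dα` vanishes along a section of the characteristic
distribution. -/
theorem mfderiv_charBilin_apply {α : ∀ x : M, TangentSpace (𝓡 n) x →L[ℝ] ℝ}
    (hα : IsSmoothOneForm α) {N X Y : ∀ x : M, TangentSpace (𝓡 n) x} {x : M}
    (hN : SmoothFieldAt N x) (hX : SmoothFieldAt X x) (hY : SmoothFieldAt Y x)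
    (hNα : ∀ᶠ y in 𝓝 x, N y ∈ charDistribution α y) :
    mfderiv (𝓡 n) 𝓘(ℝ, ℝ) (fun y ↦ charBilin α y (X y) (Y y)) x (N x) =
      charBilin α x (VectorField.mlieBracket (𝓡 n) N X x) (Y x) +
        charBilin α x (X x) (VectorField.mlieBracket (𝓡 n) N Y x) := by
  have htgt : ∀ᶠ z in 𝓝 (extChartAt (𝓡 n) x x), z ∈ (extChartAt (𝓡 n) x).target :=
    (isOpen_extChartAt_target x).mem_nhds (mem_extChartAt_target (I := 𝓡 n) x)
  have hchar : ∀ᶠ z in 𝓝 (extChartAt (𝓡 n) x x), N ((extChartAt (𝓡 n) x).symm z) ∈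
      charDistribution α ((extChartAt (𝓡 n) x).symm z) := by
    have hc := continuousAt_extChartAt_symm (I := 𝓡 n) x
    rw [ContinuousAt, extChartAt_to_inv] at hc
    exact hc.eventually hNα
  have hb : ∀ᶠ z in 𝓝 (extChartAt (𝓡 n) x x), charBilin α ((extChartAt (𝓡 n) x).symm z)
      (X ((extChartAt (𝓡 n) x).symm z)) (Y ((extChartAt (𝓡 n) x).symm z)) =
      flatBilin (inChart α x) z (fieldInChart X x z) (fieldInChart Y x z) := by
    filter_upwards [htgt] with z hz
    rw [charBilin_eq hα ((extChartAt (𝓡 n) x).map_target hz), PartialEquiv.right_inv _ hz]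
    rfl
  rw [mfderiv_eq_fderiv_chart (((smoothBilinAt_charBilin hα x).apply hX hY).mdifferentiableAt
    (by simp)), Filter.EventuallyEq.fderiv_eq hb]
  have hflat := fderiv_flatBilin_apply (contDiffAt_inChart hα (mem_extChartAt_target x))
    (hN.contDiffAt_fieldInChart.differentiableAt (by simp))
    (hX.contDiffAt_fieldInChart.differentiableAt (by simp))
    (hY.contDiffAt_fieldInChart.differentiableAt (by simp)) ?_ ?_
  · rw [← mlieBracket_eq_lieBracket, ← mlieBracket_eq_lieBracket] at hflat
    simp only [fieldInChart_self] at hflat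
    refine hflat.trans ?_
    rw [charBilin_eq hα (mem_extChartAt_source x), charBilin_eq hα (mem_extChartAt_source x)]
    simp only [tcoord_self]
  · filter_upwards [htgt, hchar] with z hz hz'
    rw [← hz'.1, ← inChart_tcoord ((extChartAt (𝓡 n) x).map_target hz),
      PartialEquiv.right_inv _ hz]
    rfl
  · filter_upwards [htgt, hchar] with z hz hz' w
    have h := hz'.2 (constField x w _)
    rw [extDerivOneForm_eq hα ((extChartAt (𝓡 n) x).map_target hz), PartialEquiv.right_inv _ hz,
      tcoord_constField ((extChartAt (𝓡 n) x).map_target hz)] at h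
    exact h

end Calculus

/-! ### The characteristic distributions: ranks, involutivity, smooth projections -/

section Foliations

open Module

variable {n : ℕ} {M : Type*} [TopologicalSpace M] [ChartedSpace (EuclideanSpace ℝ (Fin n)) M]

/-- Testing against w = v removes dα and leaves α(v)² = 0; then dα(v, ·) = 0 remains. -/
theorem mem_charDistribution_iff_charBilin (α : ∀ x : M, TangentSpace (𝓡 n) x →L[ℝ] ℝ) {x : M}
    {v : TangentSpace (𝓡 n) x} : v ∈ charDistribution α x ↔ ∀ w, charBilin α x v w = 0 := by
  refine ⟨fun h w ↦ by rw [charBilin_apply, h.1, h.2, zero_mul, add_zero], fun h ↦ ?_⟩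
  have h0 : α x v = 0 := by
    have h1 := h v
    rw [charBilin_apply] at h1
    have h2 : extDerivOneForm α x ![v, v] = 0 := form_self (extDerivOneForm α x).toAlternatingMap v
    rw [h2, add_zero] at h1
    exact mul_self_eq_zero.1 h1
  refine ⟨h0, fun w ↦ ?_⟩
  have h1 := h w
  rwa [charBilin_apply, h0, zero_mul, zero_add] at h1

theorem charBilin_left {α : ∀ x : M, TangentSpace (𝓡 n) x →L[ℝ] ℝ} {x : M}
    {v : TangentSpace (𝓡 n) x} (hv : v ∈ charDistribution α x) (w : TangentSpace (𝓡 n) x) :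
    charBilin α x v w = 0 := (mem_charDistribution_iff_charBilin α).1 hv w

theorem charBilin_right {α : ∀ x : M, TangentSpace (𝓡 n) x →L[ℝ] ℝ} {x : M}
    {v : TangentSpace (𝓡 n) x} (hv : v ∈ charDistribution α x) (w : TangentSpace (𝓡 n) x) :
    charBilin α x w v = 0 := by
  rw [charBilin_apply, hv.1, mul_zero, zero_add]
  have h : extDerivOneForm α x ![w, v] = -extDerivOneForm α x ![v, w] :=
    form_swap (extDerivOneForm α x).toAlternatingMap w v
  rw [h, hv.2, neg_zero]

/-- A common vector annihilates each of the four factors of the volume form, hence the form itself.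
-/
theorem disjoint_charDistribution {h k : ℕ} {α₁ α₂ : ∀ x : M, TangentSpace (𝓡 n) x →L[ℝ] ℝ}
    (hn : n = 2 * h + 2 * k + 2) {x : M} (hv : contactPairForm h k α₁ α₂ x ≠ 0) :
    Disjoint (charDistribution α₁ x) (charDistribution α₂ x) := by
  rw [Submodule.disjoint_def]
  intro v h1 h2
  have hN : finrank ℝ (TangentSpace (𝓡 n) x) = ((1 + 2 * h) + 1) + 2 * k := by
    have : finrank ℝ (TangentSpace (𝓡 n) x) = n := finrank_euclideanSpace_fin
    omega
  refine eq_zero_of_top_form hN _ hv fun u i hi ↦ ?_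
  refine wedge_apply_eq_zero _ _ (fun u i hi ↦ ?_) (fun u i hi ↦ ?_) u i hi
  · refine wedge_apply_eq_zero _ _ (fun u i hi ↦ ?_) (fun u i hi ↦ ?_) u i hi
    · refine wedge_apply_eq_zero _ _ (fun u i hi ↦ ?_) (fun u i hi ↦ ?_) u i hi
      · exact oneForm_apply_eq_zero _ h1.1 u i hi
      · exact wedgePow_apply_eq_zero _ h1.2 _ u i hi
    · exact oneForm_apply_eq_zero _ h2.1 u i hi
  · exact wedgePow_apply_eq_zero _ h2.2 _ u i hi

variable [IsManifold (𝓡 n) ∞ M]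

/-- Two smooth `1`-forms whose characteristic distributions are complementary, of constant
ranks `p` and `q`. -/
structure IsComplementaryPair (p q : ℕ) (α₁ α₂ : ∀ x : M, TangentSpace (𝓡 n) x →L[ℝ] ℝ) :
    Prop where
  smooth₁ : IsSmoothOneForm α₁
  smooth₂ : IsSmoothOneForm α₂
  isCompl : ∀ x : M, IsCompl (charDistribution α₁ x) (charDistribution α₂ x)
  finrank₁ : ∀ x : M, finrank ℝ (charDistribution α₁ x) = p
  finrank₂ : ∀ x : M, finrank ℝ (charDistribution α₂ x) = q

theorem IsComplementaryPair.symm {p q : ℕ} {α₁ α₂ : ∀ x : M, TangentSpace (𝓡 n) x →L[ℝ] ℝ}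
    (hα : IsComplementaryPair p q α₁ α₂) : IsComplementaryPair q p α₂ α₁ :=
  ⟨hα.smooth₂, hα.smooth₁, fun x ↦ (hα.isCompl x).symm, hα.finrank₂, hα.finrank₁⟩

/-- The codimension bounds 2h+1 and 2k+1 add up to n, while disjointness bounds the sum of the
dimensions by n; so all these inequalities are equalities. -/
theorem IsContactPair.isComplementaryPair {h k : ℕ}
    {α₁ α₂ : ∀ x : M, TangentSpace (𝓡 n) x →L[ℝ] ℝ} (hα : IsContactPair h k α₁ α₂) :
    IsComplementaryPair (2 * k + 1) (2 * h + 1) α₁ α₂ := by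
  have hdisj : ∀ x : M, Disjoint (charDistribution α₁ x) (charDistribution α₂ x) :=
    fun x ↦ disjoint_charDistribution hα.dim_eq (hα.volume x)
  have hdim : ∀ x : M, finrank ℝ (TangentSpace (𝓡 n) x) = 2 * h + 2 * k + 2 := fun x ↦
    (finrank_euclideanSpace_fin (𝕜 := ℝ) (n := n)).trans hα.dim_eq
  have h1 : ∀ x : M, finrank ℝ (TangentSpace (𝓡 n) x) ≤
      finrank ℝ (charDistribution α₁ x) + (2 * h + 1) := fun x ↦
    finrank_ge_of_wedgePow_eq_zero _ (α₁ x : TangentSpace (𝓡 n) x →ₗ[ℝ] ℝ) (hα.pow_eq_zero₁ x) _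
      fun v hv hw ↦ ⟨hv, hw⟩
  have h2 : ∀ x : M, finrank ℝ (TangentSpace (𝓡 n) x) ≤
      finrank ℝ (charDistribution α₂ x) + (2 * k + 1) := fun x ↦
    finrank_ge_of_wedgePow_eq_zero _ (α₂ x : TangentSpace (𝓡 n) x →ₗ[ℝ] ℝ) (hα.pow_eq_zero₂ x) _
      fun v hv hw ↦ ⟨hv, hw⟩
  have hle : ∀ x : M, finrank ℝ (charDistribution α₁ x) + finrank ℝ (charDistribution α₂ x) ≤
      finrank ℝ (TangentSpace (𝓡 n) x) := fun x ↦ by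
    have h3 := Submodule.finrank_sup_add_finrank_inf_eq (charDistribution α₁ x)
      (charDistribution α₂ x)
    rw [(hdisj x).eq_bot, finrank_bot, add_zero] at h3
    rw [← h3]
    exact Submodule.finrank_le _
  have e1 : ∀ x : M, finrank ℝ (charDistribution α₁ x) = 2 * k + 1 := fun x ↦ by
    have := hdim x; have := h1 x; have := h2 x; have := hle x
    omega
  have e2 : ∀ x : M, finrank ℝ (charDistribution α₂ x) = 2 * h + 1 := fun x ↦ by
    have := hdim x; have := h1 x; have := h2 x; have := hle x
    omega
  refine ⟨hα.smooth₁, hα.smooth₂, fun x ↦ ?_, e1, e2⟩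
  refine Submodule.isCompl_iff_disjoint _ _ ?_ |>.2 (hdisj x)
  rw [hdim, e1, e2]
  omega

/-- The characteristic distribution is involutive. -/
theorem mlieBracket_mem_charDistribution {α : ∀ x : M, TangentSpace (𝓡 n) x →L[ℝ] ℝ}
    (hα : IsSmoothOneForm α) {U : Set M} (hU : IsOpen U) {X Y : ∀ y : M, TangentSpace (𝓡 n) y}
    (hX : SmoothFieldOn X U) (hY : SmoothFieldOn Y U) (hXα : ∀ y ∈ U, X y ∈ charDistribution α y)
    (hYα : ∀ y ∈ U, Y y ∈ charDistribution α y) {y : M} (hy : y ∈ U) :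
    VectorField.mlieBracket (𝓡 n) X Y y ∈ charDistribution α y := by
  rw [mem_charDistribution_iff_charBilin]
  intro w
  have hXe : ∀ᶠ z in 𝓝 y, X z ∈ charDistribution α z :=
    Filter.mem_of_superset (hU.mem_nhds hy) hXα
  -- Let W be the constant field through w. Near y the function β(Y, W) is zero because Y lies in
  -- the kernel, and β(Y, [X, W]) is zero for the same reason; invariance along X leaves β([X, Y],
  -- W) = 0.
  have h := mfderiv_charBilin_apply hα (hX.smoothFieldAt hU hy) (hY.smoothFieldAt hU hy)
    (smoothFieldAt_constField (mem_extChartAt_source y) w) hXe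
  have h0 : (fun z ↦ charBilin α z (Y z) (constField y w z)) =ᶠ[𝓝 y] fun _ ↦ (0 : ℝ) := by
    filter_upwards [hU.mem_nhds hy] with z hz using charBilin_left (hYα z hz) _
  rw [h0.mfderiv_eq, mfderiv_const] at h
  have h1 : constField y w y = w := constField_self y w
  have h2 := charBilin_left (hYα y hy) (VectorField.mlieBracket (𝓡 n) X (constField y w) y)
  refine (congrArg (charBilin α y (VectorField.mlieBracket (𝓡 n) X Y y)) h1).symm.trans ?_
  refine (add_zero _).symm.trans ((congrArg (_ + ·) h2.symm).trans (h.symm.trans rfl))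

/-- A vector field is smooth if its image under a smooth nondegenerate bilinear form is. -/
theorem smoothFieldAt_of_bilin
    {b : ∀ x : M, TangentSpace (𝓡 n) x →L[ℝ] TangentSpace (𝓡 n) x →L[ℝ] ℝ} {x : M}
    (hb : SmoothBilinAt b x) (hnd : ∀ v, (∀ w, b x v w = 0) → v = 0)
    {Y : ∀ y : M, TangentSpace (𝓡 n) y}
    (hY : ∀ u, ContMDiffAt (𝓡 n) 𝓘(ℝ, ℝ) ∞ (fun y ↦ b y (Y y) (constField x u y)) x) :
    SmoothFieldAt Y x := by
  have hsrc := mem_extChartAt_source (I := 𝓡 n) x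
  let E := EuclideanSpace ℝ (Fin n)
  let C : ∀ y : M, E →L[ℝ] TangentSpace (𝓡 n) y := fun y ↦
    (trivializationAt E (TangentSpace (𝓡 n)) x).symmL ℝ y
  let φ : ∀ y : M, TangentSpace (𝓡 n) y → E →L[ℝ] ℝ := fun y v ↦ (b y v).comp (C y)
  let B : M → E →L[ℝ] E →L[ℝ] ℝ := fun y ↦
    (LinearMap.mk₂ ℝ (fun u v ↦ b y (C y u) (C y v)) (fun _ _ _ ↦ by simp) (fun _ _ _ ↦ by simp)
      (fun _ _ _ ↦ by simp) (fun _ _ _ ↦ by simp)).toContinuousBilinearMap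
  have hB : ContMDiffAt (𝓡 n) 𝓘(ℝ, E →L[ℝ] E →L[ℝ] ℝ) ∞ B x :=
    contMDiffAt_clm_of_apply fun u ↦ contMDiffAt_clm_of_apply fun v ↦
      hb.apply (smoothFieldAt_constField hsrc u) (smoothFieldAt_constField hsrc v)
  have hφ : ContMDiffAt (𝓡 n) 𝓘(ℝ, E →L[ℝ] ℝ) ∞ (fun y ↦ φ y (Y y)) x :=
    contMDiffAt_clm_of_apply hY
  have hinj : Function.Injective (B x) := by
    rw [injective_iff_map_eq_zero]
    intro u hu
    have h1 : constField x u x = 0 := hnd _ fun w ↦ by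
      have h2 : b x (constField x u x) (constField x (tcoord x x w) x) = 0 :=
        congrArg (fun f : E →L[ℝ] ℝ ↦ f (tcoord x x w)) hu
      rwa [constField_tcoord hsrc] at h2
    rw [← tcoord_constField hsrc u, h1, map_zero]
  let L : E ≃L[ℝ] (E →L[ℝ] ℝ) := (LinearMap.linearEquivOfInjective (B x : E →ₗ[ℝ] E →L[ℝ] ℝ) hinj
    (by rw [← (LinearMap.toContinuousLinearMap (𝕜 := ℝ) (E := E) (F' := ℝ)).finrank_eq,
      Module.finrank_linearMap_self])).toContinuousLinearEquiv
  have hL : (L : E →L[ℝ] E →L[ℝ] ℝ) = B x := by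
    ext u : 1
    rfl
  rw [smoothFieldAt_iff hsrc]
  -- In coordinates Y = B⁻¹ φ, and inversion of operators is smooth near the invertible `B x`.
  have hinv : ContMDiffAt (𝓡 n) 𝓘(ℝ, (E →L[ℝ] ℝ) →L[ℝ] E) ∞
      (fun y ↦ ContinuousLinearMap.inverse (B y)) x := by
    have h1 := contDiffAt_map_inverse (n := ∞) L
    rw [hL] at h1
    exact (contMDiffAt_iff_contDiffAt.2 h1).comp x hB
  refine (hinv.clm_apply hφ).congr_of_eventuallyEq ?_
  have hev : ∀ᶠ y in 𝓝 x, B y ∈ range ((↑) : (E ≃L[ℝ] (E →L[ℝ] ℝ)) → E →L[ℝ] E →L[ℝ] ℝ) := by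
    refine hB.continuousAt.eventually ?_
    rw [← hL]
    exact L.nhds
  filter_upwards [hev, (isOpen_extChartAt_source x).mem_nhds hsrc] with y ⟨e, he⟩ hy
  have h1 : φ y (Y y) = e (tcoord x y (Y y)) := by
    rw [show e (tcoord x y (Y y)) = B y (tcoord x y (Y y)) from
      congrArg (fun f : E →L[ℝ] E →L[ℝ] ℝ ↦ f (tcoord x y (Y y))) he]
    exact congrArg (φ y) (constField_tcoord hy (Y y)).symm
  rw [h1, ← he, ContinuousLinearMap.inverse_equiv]
  exact (e.symm_apply_apply _).symm

theorem linearIndependent_tcoord {ι : Type*} {x₀ y : M}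
    (hy : y ∈ (extChartAt (𝓡 n) x₀).source) {s : ι → TangentSpace (𝓡 n) y}
    (hs : LinearIndependent ℝ s) : LinearIndependent ℝ (fun i ↦ tcoord x₀ y (s i)) := by
  have hinj : Function.Injective (tcoord x₀ y) :=
    fun v w h ↦ by rw [← constField_tcoord hy v, h, constField_tcoord hy w]
  have h := (tcoord x₀ y).toLinearMap.linearIndependent_iff_of_injOn (v := s) hinj.injOn
  exact h.2 hs

theorem eventually_linearIndependent {ι : Type*} [Finite ι] {x : M}
    {s : ι → ∀ y : M, TangentSpace (𝓡 n) y} (hs : ∀ i, SmoothFieldAt (s i) x)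
    (hli : LinearIndependent ℝ (fun i ↦ s i x)) :
    ∀ᶠ y in 𝓝 x, LinearIndependent ℝ (fun i ↦ s i y) := by
  have hsrc := mem_extChartAt_source (I := 𝓡 n) x
  let f : M → ι → EuclideanSpace ℝ (Fin n) := fun y i ↦ tcoord x y (s i y)
  have hcont : ContinuousAt f x :=
    continuousAt_pi.2 fun i ↦ ((smoothFieldAt_iff hsrc _).1 (hs i)).continuousAt
  have hli' : LinearIndependent ℝ (f x) := linearIndependent_tcoord hsrc hli
  have hev : ∀ᶠ y in 𝓝 x, LinearIndependent ℝ (f y) := hcont.eventually hli'.eventually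
  filter_upwards [hev] with y hy
  exact LinearIndependent.of_comp (tcoord x y).toLinearMap hy

namespace IsComplementaryPair

variable {p q : ℕ} {α₁ α₂ : ∀ x : M, TangentSpace (𝓡 n) x →L[ℝ] ℝ}

/-- The projection to the first characteristic distribution along the second one. -/
def proj (hα : IsComplementaryPair p q α₁ α₂) (x : M) :
    TangentSpace (𝓡 n) x →L[ℝ] TangentSpace (𝓡 n) x :=
  LinearMap.toContinuousLinearMap
    ((charDistribution α₁ x).projection (charDistribution α₂ x) (hα.isCompl x))

theorem proj_mem (hα : IsComplementaryPair p q α₁ α₂) {x : M} (v : TangentSpace (𝓡 n) x) :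
    hα.proj x v ∈ charDistribution α₁ x :=
  Submodule.projection_apply_mem (hα.isCompl x) v

theorem proj_of_mem (hα : IsComplementaryPair p q α₁ α₂) {x : M} {v : TangentSpace (𝓡 n) x}
    (hv : v ∈ charDistribution α₁ x) : hα.proj x v = v :=
  Submodule.projection_apply_of_mem_left (hα.isCompl x) hv

theorem proj_of_mem_right (hα : IsComplementaryPair p q α₁ α₂) {x : M}
    {v : TangentSpace (𝓡 n) x} (hv : v ∈ charDistribution α₂ x) : hα.proj x v = 0 :=
  (Submodule.projection_apply_eq_zero_iff (hα.isCompl x)).2 hv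

theorem proj_add_proj_symm (hα : IsComplementaryPair p q α₁ α₂) {x : M}
    (v : TangentSpace (𝓡 n) x) : hα.proj x v + hα.symm.proj x v = v :=
  Submodule.projection_add_projection_eq_self (hα.isCompl x) v

theorem charBilin_proj (hα : IsComplementaryPair p q α₁ α₂) {x : M}
    (v w : TangentSpace (𝓡 n) x) : charBilin α₂ x (hα.proj x v) w = charBilin α₂ x v w := by
  conv_rhs => rw [← hα.proj_add_proj_symm v, map_add]
  rw [add_apply, charBilin_left (hα.symm.proj_mem v), add_zero]

/-- Against vectors of the first distribution only β₂ survives, so v is in the kernel of β₂; then β₁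
alone remains and v is in its kernel as well. -/
theorem nondegenerate (hα : IsComplementaryPair p q α₁ α₂) {x : M} {v : TangentSpace (𝓡 n) x}
    (hv : ∀ w, (charBilin α₁ x + charBilin α₂ x) v w = 0) : v = 0 := by
  have h2 : v ∈ charDistribution α₂ x := by
    rw [mem_charDistribution_iff_charBilin]
    intro w
    have h := hv (hα.proj x w)
    rw [add_apply, add_apply,
      charBilin_right (hα.proj_mem w), zero_add] at h
    rw [← hα.proj_add_proj_symm w, map_add, h, charBilin_right (hα.symm.proj_mem w), add_zero]
  have h1 : v ∈ charDistribution α₁ x := by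
    rw [mem_charDistribution_iff_charBilin]
    intro w
    have h := hv w
    rwa [add_apply, add_apply,
      charBilin_left h2, add_zero] at h
  exact Submodule.disjoint_def.1 (hα.isCompl x).disjoint v h1 h2

/-- The projection is characterized by (β₁ + β₂)(proj X, ·) = β₂(X, ·), a smooth nondegenerate
linear system. Smoothness of the distributions follows from this, by projecting constant fields. -/
theorem smoothFieldAt_proj (hα : IsComplementaryPair p q α₁ α₂)
    {X : ∀ y : M, TangentSpace (𝓡 n) y} {x : M} (hX : SmoothFieldAt X x) :
    SmoothFieldAt (fun y ↦ hα.proj y (X y)) x := by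
  have h1 := smoothBilinAt_charBilin hα.smooth₁ x
  have h2 := smoothBilinAt_charBilin hα.smooth₂ x
  have hsrc := mem_extChartAt_source (I := 𝓡 n) x
  refine smoothFieldAt_of_bilin (b := fun y ↦ charBilin α₁ y + charBilin α₂ y) ?_
    (fun v ↦ hα.nondegenerate) fun u ↦ ?_
  · exact smoothBilinAt_of_constField fun u v ↦
      (h1.apply (smoothFieldAt_constField hsrc u) (smoothFieldAt_constField hsrc v)).add
        (h2.apply (smoothFieldAt_constField hsrc u) (smoothFieldAt_constField hsrc v))
  · refine (h2.apply hX (smoothFieldAt_constField hsrc u)).congr_of_eventuallyEq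
      (Filter.Eventually.of_forall fun y ↦ ?_)
    change charBilin α₁ y (hα.proj y (X y)) _ + charBilin α₂ y (hα.proj y (X y)) _ = _
    rw [charBilin_left (hα.proj_mem _), zero_add, hα.charBilin_proj]

/-- Smooth local frames of the first characteristic distribution. -/
theorem exists_frame (hα : IsComplementaryPair p q α₁ α₂) (x : M) :
    ∃ U : Set M, IsOpen U ∧ x ∈ U ∧ ∃ s : Fin p → ∀ y : M, TangentSpace (𝓡 n) y,
      (∀ i, SmoothFieldOn (s i) U) ∧ ∀ y ∈ U, LinearIndependent ℝ (fun i ↦ s i y) ∧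
        Submodule.span ℝ (range fun i ↦ s i y) = charDistribution α₁ y := by
  let b := Module.finBasisOfFinrankEq ℝ (charDistribution α₁ x) (hα.finrank₁ x)
  let s : Fin p → ∀ y : M, TangentSpace (𝓡 n) y := fun i y ↦
    hα.proj y (constField x (b i : TangentSpace (𝓡 n) x) y)
  have hs : ∀ i, ∀ y ∈ (extChartAt (𝓡 n) x).source, SmoothFieldAt (s i) y := fun i y hy ↦
    hα.smoothFieldAt_proj (smoothFieldAt_constField hy _)
  have hsx : ∀ i, s i x = b i := fun i ↦ by
    have h1 : constField x (b i : TangentSpace (𝓡 n) x) x = (b i : TangentSpace (𝓡 n) x) :=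
      constField_self x _
    exact (congrArg (hα.proj x) h1).trans (hα.proj_of_mem (b i).2)
  have hsrc := mem_extChartAt_source (I := 𝓡 n) x
  have hli : LinearIndependent ℝ (fun i ↦ s i x) := by
    simp only [hsx]
    exact b.linearIndependent.map' (Submodule.subtype _) (Submodule.ker_subtype _)
  have hev := Filter.Eventually.and ((isOpen_extChartAt_source x).mem_nhds hsrc)
    (eventually_linearIndependent (fun i ↦ hs i x hsrc) hli)
  obtain ⟨U, hU, hUo, hxU⟩ := mem_nhds_iff.1 hev
  refine ⟨U, hUo, hxU, s, fun i y hy ↦ (hs i y (hU hy).1).contMDiffWithinAt, fun y hy ↦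
    ⟨(hU hy).2, Submodule.eq_of_le_of_finrank_eq ?_ ?_⟩⟩
  · rw [Submodule.span_le]
    rintro _ ⟨i, rfl⟩
    exact hα.proj_mem _
  · rw [finrank_span_eq_card (hU hy).2, Fintype.card_fin, hα.finrank₁]

theorem isFoliation (hα : IsComplementaryPair p q α₁ α₂) :
    IsFoliation (charDistribution α₁) p where
  exists_frame := hα.exists_frame
  involutive _ hU _ _ hX hY hXα hYα _ hy :=
    mlieBracket_mem_charDistribution hα.smooth₁ hU hX hY hXα hYα hy

end IsComplementaryPair

end Foliations

/-! ### Gram determinants of bilinear forms -/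

section Gram

open Matrix

variable {V : Type*} [AddCommGroup V] [Module ℝ V] [TopologicalSpace V] {p : ℕ}

/-- The Gram matrix of a family of vectors. -/
def gram (b : V →L[ℝ] V →L[ℝ] ℝ) (s : Fin p → V) : Matrix (Fin p) (Fin p) ℝ :=
  Matrix.of fun i j ↦ b (s i) (s j)

theorem gram_apply (b : V →L[ℝ] V →L[ℝ] ℝ) (s : Fin p → V) (i j : Fin p) :
    gram b s i j = b (s i) (s j) := rfl

theorem gram_sum_smul (b : V →L[ℝ] V →L[ℝ] ℝ) (s : Fin p → V) (A : Matrix (Fin p) (Fin p) ℝ) :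
    gram b (fun i ↦ ∑ j, A i j • s j) = A * gram b s * Aᵀ := by
  ext i j
  simp only [gram_apply, map_sum, map_smul, Matrix.mul_apply, Matrix.transpose_apply,
    FunLike.coe_sum, FunLike.coe_smul, Finset.sum_apply, Pi.smul_apply, smul_eq_mul,
    Finset.mul_sum, Finset.sum_mul]
  refine Finset.sum_congr rfl fun k _ ↦ ?_
  refine Finset.sum_congr rfl fun l _ ↦ ?_
  ring

theorem det_gram_sum_smul (b : V →L[ℝ] V →L[ℝ] ℝ) (s : Fin p → V)
    (A : Matrix (Fin p) (Fin p) ℝ) :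
    (gram b (fun i ↦ ∑ j, A i j • s j)).det = A.det ^ 2 * (gram b s).det := by
  rw [gram_sum_smul, det_mul, det_mul, det_transpose]
  ring

/-- A left null vector of the Gram matrix gives a combination of the frame that is left-orthogonal
to `D`. No symmetry of `b` is needed, which matters for α ⊗ α + dα. -/
theorem det_gram_ne_zero {b : V →L[ℝ] V →L[ℝ] ℝ} {s : Fin p → V} (hs : LinearIndependent ℝ s)
    {D : Submodule ℝ V} (hD : Submodule.span ℝ (range s) = D)
    (hb : ∀ v ∈ D, (∀ w ∈ D, b v w = 0) → v = 0) : (gram b s).det ≠ 0 := by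
  intro h
  obtain ⟨c, hc, hc0⟩ := Matrix.exists_vecMul_eq_zero_iff.2 h
  have hmem : ∀ i, s i ∈ D := fun i ↦ hD ▸ Submodule.subset_span ⟨i, rfl⟩
  have hv : ∑ i, c i • s i = 0 := by
    refine hb _ (Submodule.sum_mem _ fun i _ ↦ Submodule.smul_mem _ _ (hmem i)) fun w hw ↦ ?_
    rw [← hD] at hw
    induction hw using Submodule.span_induction with
    | mem w hw =>
      obtain ⟨j, rfl⟩ := hw
      have h1 := congrFun hc0 j
      simp only [vecMul, dotProduct, gram_apply, Pi.zero_apply] at h1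
      rw [← h1]
      simp
    | zero => simp
    | add u w _ _ hu hw => rw [map_add, hu, hw, add_zero]
    | smul a w _ hw => rw [map_smul, hw, smul_zero]
  exact hc (funext (Fintype.linearIndependent_iff.1 hs c hv))

theorem det_gram_ne_zero_of_pos {b : V →L[ℝ] V →L[ℝ] ℝ} (hb : ∀ v, v ≠ 0 → 0 < b v v)
    {s : Fin p → V} (hs : LinearIndependent ℝ s) : (gram b s).det ≠ 0 :=
  det_gram_ne_zero hs rfl fun v hv h ↦ by
    by_contra hne
    exact (hb v hne).ne' (h v hv)

/-- A change of frame multiplies the Gram determinants of both forms by the same factor, so their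
ratio does not depend on the frame. -/
theorem det_gram_sq_mul {β b : V →L[ℝ] V →L[ℝ] ℝ} {s : Fin p → V} (t : Fin p → V)
    (ht : ∀ i, t i ∈ Submodule.span ℝ (range s)) :
    (gram β t).det ^ 2 * (gram b s).det ^ 2 = (gram β s).det ^ 2 * (gram b t).det ^ 2 := by
  have h : ∀ i, ∃ c : Fin p → ℝ, ∑ j, c j • s j = t i := fun i ↦
    (Submodule.mem_span_range_iff_exists_fun ℝ).1 (ht i)
  choose A hA using h
  have h1 : t = fun i ↦ ∑ j, (Matrix.of A) i j • s j := funext fun i ↦ (hA i).symm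
  rw [h1, det_gram_sum_smul, det_gram_sum_smul]
  ring

end Gram

/-! ### Existence of smooth Riemannian metrics -/

set_option synthInstance.maxHeartbeats 400000 in
/-- The unit ball of a positive definite form is bounded. -/
theorem isVonNBounded_of_pos {E : Type*} [NormedAddCommGroup E] [NormedSpace ℝ E]
    [FiniteDimensional ℝ E] (b : E →L[ℝ] E →L[ℝ] ℝ) (hb : ∀ v, v ≠ 0 → 0 < b v v) :
    Bornology.IsVonNBounded ℝ {v : E | b v v < 1} := by
  rw [NormedSpace.isVonNBounded_iff]
  rcases subsingleton_or_nontrivial E with _ | _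
  · exact (Set.toFinite _).isBounded
  obtain ⟨v₀, hv₀, hmin⟩ := (isCompact_sphere (0 : E) 1).exists_isMinOn
    ((NormedSpace.sphere_nonempty (x := (0 : E)) (r := 1)).2 zero_le_one)
    (f := fun v ↦ b v v) (b.continuous.clm_apply continuous_id).continuousOn
  have hc : 0 < b v₀ v₀ := hb v₀ (by rintro rfl; simp at hv₀)
  rw [isBounded_iff_forall_norm_le]
  refine ⟨1 + (b v₀ v₀)⁻¹, fun v hv ↦ ?_⟩
  have hv : b v v < 1 := hv
  rcases eq_or_ne v 0 with rfl | hne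
  · rw [norm_zero]; positivity
  have hn : 0 < ‖v‖ := norm_pos_iff.2 hne
  have h1 : b v₀ v₀ ≤ b (‖v‖⁻¹ • v) (‖v‖⁻¹ • v) := hmin (by
    rw [mem_sphere_zero_iff_norm, norm_smul, norm_inv, norm_norm, inv_mul_cancel₀ hn.ne'])
  simp only [map_smul, FunLike.coe_smul, Pi.smul_apply, smul_eq_mul] at h1
  have h2 : b v₀ v₀ * ‖v‖ ^ 2 ≤ b v v := by
    have := mul_le_mul_of_nonneg_right h1 (sq_nonneg ‖v‖)
    calc _ ≤ _ := this
      _ = _ := by field_simp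
  have h3 : ‖v‖ ^ 2 ≤ (b v₀ v₀)⁻¹ := by
    rw [le_inv_comm₀ (by positivity) hc, ← one_div, le_div_iff₀ (by positivity)]
    linarith
  -- The bound is ‖v‖ ≤ 1 + ‖v‖².
  nlinarith [sq_nonneg (‖v‖ - 1)]

section Metric

open Module

variable {n : ℕ} {M : Type*} [TopologicalSpace M] [ChartedSpace (EuclideanSpace ℝ (Fin n)) M]

/-- The continuous bilinear form with the given values. -/
def mkBilin {x : M} (f : TangentSpace (𝓡 n) x → TangentSpace (𝓡 n) x → ℝ)
    (h₁ : ∀ u v w, f (u + v) w = f u w + f v w) (h₂ : ∀ (c : ℝ) v w, f (c • v) w = c • f v w)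
    (h₃ : ∀ u v w, f u (v + w) = f u v + f u w) (h₄ : ∀ (c : ℝ) v w, f v (c • w) = c • f v w) :
    TangentSpace (𝓡 n) x →L[ℝ] TangentSpace (𝓡 n) x →L[ℝ] ℝ :=
  (LinearMap.mk₂ ℝ f h₁ h₂ h₃ h₄).toContinuousBilinearMap

/-- Convexity is what allows local inner products to be glued by a partition of unity. -/
theorem convex_inner (x : M) :
    Convex ℝ {b : TangentSpace (𝓡 n) x →L[ℝ] TangentSpace (𝓡 n) x →L[ℝ] ℝ |
      (∀ v w, b v w = b w v) ∧ ∀ v, v ≠ 0 → 0 < b v v} := by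
  intro b hb c hc r t hr ht hrt
  refine ⟨fun v w ↦ ?_, fun v hv ↦ ?_⟩
  · change r * b v w + t * c v w = r * b w v + t * c w v
    rw [hb.1, hc.1]
  · change 0 < r * b v v + t * c v v
    have h1 := hb.2 v hv
    have h2 := hc.2 v hv
    rcases hr.eq_or_lt with rfl | hr
    · have : t = 1 := by linarith
      subst this
      simpa using h2
    · have := mul_nonneg ht h2.le
      have := mul_pos hr h1
      linarith

variable [IsManifold (𝓡 n) ∞ M]

theorem exists_local_smooth_inner (x : M) : ∃ U ∈ 𝓝 x,
    ∃ b : ∀ x : M, TangentSpace (𝓡 n) x →L[ℝ] TangentSpace (𝓡 n) x →L[ℝ] ℝ,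
      (∀ y ∈ U, SmoothBilinAt b y) ∧
        ∀ y ∈ U, (∀ v w, b y v w = b y w v) ∧ ∀ v, v ≠ 0 → 0 < b y v v := by
  let b : ∀ y : M, TangentSpace (𝓡 n) y →L[ℝ] TangentSpace (𝓡 n) y →L[ℝ] ℝ := fun y ↦
    mkBilin (fun v w ↦ inner ℝ (tcoord x y v) (tcoord x y w))
      (fun _ _ _ ↦ by rw [map_add, inner_add_left])
      (fun _ _ _ ↦ by rw [map_smul, real_inner_smul_left]; rfl)
      (fun _ _ _ ↦ by rw [map_add, inner_add_right])
      (fun _ _ _ ↦ by rw [map_smul, real_inner_smul_right]; rfl)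
  refine ⟨(extChartAt (𝓡 n) x).source, (isOpen_extChartAt_source x).mem_nhds
    (mem_extChartAt_source x), b, fun y hy ↦ ?_, fun y hy ↦ ⟨fun v w ↦ ?_, fun v hv ↦ ?_⟩⟩
  · exact smoothBilinAt_of_constField fun u v ↦
      contDiff_inner.contMDiff.contMDiffAt.comp y (ContMDiffAt.prodMk_space
        ((smoothFieldAt_iff hy _).1 (smoothFieldAt_constField (mem_extChartAt_source y) u))
        ((smoothFieldAt_iff hy _).1 (smoothFieldAt_constField (mem_extChartAt_source y) v)))
  · change inner ℝ (tcoord x y v) (tcoord x y w) = inner ℝ (tcoord x y w) (tcoord x y v)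
    exact real_inner_comm _ _
  · change 0 < inner ℝ (tcoord x y v) (tcoord x y v)
    refine real_inner_self_pos.2 fun h ↦ hv ?_
    rw [← constField_tcoord hy v, h]
    exact map_zero _

set_option synthInstance.maxHeartbeats 400000 in
set_option maxHeartbeats 4000000 in
/-- Smooth Riemannian metrics exist. -/
theorem exists_smooth_inner [T2Space M] [SecondCountableTopology M] :
    ∃ b : ∀ x : M, TangentSpace (𝓡 n) x →L[ℝ] TangentSpace (𝓡 n) x →L[ℝ] ℝ,
      (∀ x, SmoothBilinAt b x) ∧ (∀ x v w, b x v w = b x w v) ∧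
        ∀ x v, v ≠ 0 → 0 < b x v v := by
  have : LocallyCompactSpace M := Manifold.locallyCompact_of_finiteDimensional (𝓡 n)
  obtain ⟨s, hs⟩ := exists_contMDiffSection_forall_mem_convex_of_local (I := 𝓡 n) (M := M)
    (n := ⊤) (F_fiber := EuclideanSpace ℝ (Fin n) →L[ℝ] EuclideanSpace ℝ (Fin n) →L[ℝ] ℝ)
    (fun x ↦ TangentSpace (𝓡 n) x →L[ℝ] TangentSpace (𝓡 n) x →L[ℝ] ℝ) _ (convex_inner (n := n))
    fun x ↦ by
      obtain ⟨U, hU, b, hb, h⟩ := exists_local_smooth_inner (n := n) x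
      exact ⟨U, hU, b, fun y hy ↦ ContMDiffAt.contMDiffWithinAt (hb y hy), h⟩
  exact ⟨s, fun x ↦ s.contMDiff_toFun x, fun x ↦ (hs x).1, fun x ↦ (hs x).2⟩

end Metric

/-! ### The metric normalized against the forms α ⊗ α + dα -/

section AdaptedMetric

open Module

variable {n : ℕ} {M : Type*} [TopologicalSpace M] [ChartedSpace (EuclideanSpace ℝ (Fin n)) M]

theorem contMDiffAt_det {p : ℕ} {A : M → Matrix (Fin p) (Fin p) ℝ} {x : M}
    (hA : ∀ i j, ContMDiffAt (𝓡 n) 𝓘(ℝ, ℝ) ∞ (fun y ↦ A y i j) x) :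
    ContMDiffAt (𝓡 n) 𝓘(ℝ, ℝ) ∞ (fun y ↦ (A y).det) x := by
  simp only [Matrix.det_apply']
  exact contMDiffAt_finsetSum fun σ _ ↦
    contMDiffAt_const.mul (contMDiffAt_finsetProd fun i _ ↦ hA _ _)

variable [IsManifold (𝓡 n) ∞ M]

namespace IsComplementaryPair

variable {p q : ℕ} {α₁ α₂ : ∀ x : M, TangentSpace (𝓡 n) x →L[ℝ] ℝ}
  {b : ∀ x : M, TangentSpace (𝓡 n) x →L[ℝ] TangentSpace (𝓡 n) x →L[ℝ] ℝ}

/-- A basis of the first characteristic distribution at `x`. -/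
def frameAt (hα : IsComplementaryPair p q α₁ α₂) (x : M) (i : Fin p) : TangentSpace (𝓡 n) x :=
  (Module.finBasisOfFinrankEq ℝ (charDistribution α₁ x) (hα.finrank₁ x) i : TangentSpace (𝓡 n) x)

theorem linearIndependent_frameAt (hα : IsComplementaryPair p q α₁ α₂) (x : M) :
    LinearIndependent ℝ (hα.frameAt x) :=
  (Module.finBasisOfFinrankEq ℝ (charDistribution α₁ x) (hα.finrank₁ x)).linearIndependent.map'
    (Submodule.subtype _) (Submodule.ker_subtype _)

theorem span_eq (hα : IsComplementaryPair p q α₁ α₂) {x : M} {s : Fin p → TangentSpace (𝓡 n) x}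
    (hli : LinearIndependent ℝ s) (hs : ∀ i, s i ∈ charDistribution α₁ x) :
    Submodule.span ℝ (range s) = charDistribution α₁ x := by
  refine Submodule.eq_of_le_of_finrank_eq ?_ ?_
  · rw [Submodule.span_le]
    rintro _ ⟨i, rfl⟩
    exact hs i
  · rw [finrank_span_eq_card hli, Fintype.card_fin, hα.finrank₁]

theorem span_frameAt (hα : IsComplementaryPair p q α₁ α₂) (x : M) :
    Submodule.span ℝ (range (hα.frameAt x)) = charDistribution α₁ x :=
  hα.span_eq (hα.linearIndependent_frameAt x) fun _ ↦ Subtype.coe_prop _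

/-- A vector of TF₁ left-orthogonal to TF₁ under β₂ is left-orthogonal to everything, TF₂ being the
right kernel; so it lies in TF₁ ∩ TF₂. -/
theorem det_gram_charBilin_ne_zero (hα : IsComplementaryPair p q α₁ α₂) {x : M}
    {s : Fin p → TangentSpace (𝓡 n) x} (hli : LinearIndependent ℝ s)
    (hs : Submodule.span ℝ (range s) = charDistribution α₁ x) :
    (gram (charBilin α₂ x) s).det ≠ 0 := by
  refine det_gram_ne_zero hli hs fun v hv h ↦ ?_
  refine Submodule.disjoint_def.1 (hα.isCompl x).disjoint v hv ?_
  rw [mem_charDistribution_iff_charBilin]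
  intro w
  rw [← hα.proj_add_proj_symm w, map_add, h _ (hα.proj_mem w),
    charBilin_right (hα.symm.proj_mem w), add_zero]

/-- The factor by which an inner product `b` has to be multiplied for the volume form of `b` and
the form `α₂ ⊗ α₂ + dα₂` to have the same determinant on the first characteristic distribution. -/
def scale (hα : IsComplementaryPair p q α₁ α₂)
    (b : ∀ x : M, TangentSpace (𝓡 n) x →L[ℝ] TangentSpace (𝓡 n) x →L[ℝ] ℝ) (x : M) : ℝ :=
  -- Scaling `b` by c multiplies its squared Gram determinant by c^(2p), hence a root of order 2p.
  -- The squares keep the base positive without any study of signs.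
  ((gram (charBilin α₂ x) (hα.frameAt x)).det ^ 2 / (gram (b x) (hα.frameAt x)).det ^ 2) ^
    ((2 * p : ℕ) : ℝ)⁻¹

/-- `frameAt` is chosen point by point with no continuity. Frame independence lets a smooth local
frame compute the factor, whence its smoothness. -/
theorem scale_eq (hα : IsComplementaryPair p q α₁ α₂) {x : M} (hb : ∀ v, v ≠ 0 → 0 < b x v v)
    {s : Fin p → TangentSpace (𝓡 n) x} (hli : LinearIndependent ℝ s)
    (hs : Submodule.span ℝ (range s) = charDistribution α₁ x) :
    hα.scale b x = ((gram (charBilin α₂ x) s).det ^ 2 / (gram (b x) s).det ^ 2) ^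
      ((2 * p : ℕ) : ℝ)⁻¹ := by
  have h1 := det_gram_ne_zero_of_pos hb hli
  have h2 := det_gram_ne_zero_of_pos hb (hα.linearIndependent_frameAt x)
  rw [scale]
  congr 1
  rw [div_eq_div_iff (pow_ne_zero 2 h2) (pow_ne_zero 2 h1)]
  refine det_gram_sq_mul _ fun i ↦ ?_
  rw [hs]
  exact Subtype.coe_prop _

theorem scale_pos (hα : IsComplementaryPair p q α₁ α₂) {x : M}
    (hb : ∀ v, v ≠ 0 → 0 < b x v v) : 0 < hα.scale b x := by
  have h1 := det_gram_ne_zero_of_pos hb (hα.linearIndependent_frameAt x)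
  have h2 := hα.det_gram_charBilin_ne_zero (hα.linearIndependent_frameAt x) (hα.span_frameAt x)
  exact Real.rpow_pos_of_pos (by positivity) _

theorem contMDiffAt_scale (hα : IsComplementaryPair p q α₁ α₂) {x : M}
    (hb : ∀ y v, v ≠ 0 → 0 < b y v v) (hbs : SmoothBilinAt b x) :
    ContMDiffAt (𝓡 n) 𝓘(ℝ, ℝ) ∞ (hα.scale b) x := by
  obtain ⟨U, hU, hxU, s, hs, hsU⟩ := hα.exists_frame x
  have hsx : ∀ i, SmoothFieldAt (s i) x := fun i ↦ (hs i).smoothFieldAt hU hxU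
  have h1 : ContMDiffAt (𝓡 n) 𝓘(ℝ, ℝ) ∞
      (fun y ↦ (gram (charBilin α₂ y) (fun i ↦ s i y)).det) x :=
    contMDiffAt_det fun i j ↦ (smoothBilinAt_charBilin hα.smooth₂ x).apply (hsx i) (hsx j)
  have h2 : ContMDiffAt (𝓡 n) 𝓘(ℝ, ℝ) ∞ (fun y ↦ (gram (b y) (fun i ↦ s i y)).det) x :=
    contMDiffAt_det fun i j ↦ hbs.apply (hsx i) (hsx j)
  have h3 := det_gram_ne_zero_of_pos (hb x) (hsU x hxU).1
  have h4 := hα.det_gram_charBilin_ne_zero (hsU x hxU).1 (hsU x hxU).2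
  have h5 : ContMDiffAt (𝓡 n) 𝓘(ℝ, ℝ) ∞ (fun y ↦
      (gram (charBilin α₂ y) (fun i ↦ s i y)).det ^ 2 *
        ((gram (b y) (fun i ↦ s i y)).det ^ 2)⁻¹) x :=
    (h1.pow 2).mul ((h2.pow 2).inv₀ (pow_ne_zero 2 h3))
  have h6 : ContDiffAt ℝ ∞ (fun r : ℝ ↦ r ^ ((2 * p : ℕ) : ℝ)⁻¹)
      ((gram (charBilin α₂ x) (fun i ↦ s i x)).det ^ 2 *
        ((gram (b x) (fun i ↦ s i x)).det ^ 2)⁻¹) :=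
    Real.contDiffAt_rpow_const_of_ne (by positivity)
  refine (h6.contMDiffAt.comp x h5).congr_of_eventuallyEq ?_
  filter_upwards [hU.mem_nhds hxU] with y hy
  exact hα.scale_eq (hb y) (hsU y hy).1 (hsU y hy).2

/-- Orthonormality gives scale^p · det(gram b) = 1, while (det gram β₂)² = scale^(2p) · (det gram
b)² in every frame. The rank must be nonzero for the root to be undone. -/
theorem det_gram_charBilin_sq_eq_one (hα : IsComplementaryPair p q α₁ α₂) (hp : p ≠ 0) {x : M}
    (hb : ∀ v, v ≠ 0 → 0 < b x v v) {s : Fin p → TangentSpace (𝓡 n) x}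
    (hs : ∀ i, s i ∈ charDistribution α₁ x)
    (ho : ∀ i j, hα.scale b x * b x (s i) (s j) = if i = j then 1 else 0) :
    (gram (charBilin α₂ x) s).det ^ 2 = 1 := by
  have h1 : hα.scale b x • gram (b x) s = 1 := by
    ext i j
    rw [Matrix.one_apply]
    exact ho i j
  have h2 : hα.scale b x ^ p * (gram (b x) s).det = 1 := by
    have := congrArg Matrix.det h1
    rwa [Matrix.det_smul, Fintype.card_fin, Matrix.det_one] at this
  have h3 := det_gram_ne_zero_of_pos hb (hα.linearIndependent_frameAt x)
  have h4 : hα.scale b x ^ (2 * p) = (gram (charBilin α₂ x) (hα.frameAt x)).det ^ 2 /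
      (gram (b x) (hα.frameAt x)).det ^ 2 :=
    Real.rpow_inv_natCast_pow (by positivity) (by omega)
  have h5 := det_gram_sq_mul (β := charBilin α₂ x) (b := b x) (s := hα.frameAt x) s fun i ↦ by
    rw [hα.span_frameAt]
    exact hs i
  rw [← eq_div_iff (pow_ne_zero 2 h3), mul_div_right_comm, ← h4] at h5
  rw [h5, pow_mul', ← mul_pow, h2, one_pow]

/-- A Riemannian metric for which the characteristic distributions are orthogonal and the forms
`αᵢ ⊗ αᵢ + dαᵢ` have determinant `± 1` in orthonormal frames. -/
theorem exists_metric [T2Space M] [SecondCountableTopology M]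
    (hα : IsComplementaryPair p q α₁ α₂) (hp : p ≠ 0) (hq : q ≠ 0) :
    ∃ g : Metric n M,
      (∀ x, ∀ v ∈ charDistribution α₁ x, ∀ w ∈ charDistribution α₂ x, g.inner x v w = 0) ∧
      (∀ x, ∀ s : Fin p → TangentSpace (𝓡 n) x, (∀ i, s i ∈ charDistribution α₁ x) →
        (∀ i j, g.inner x (s i) (s j) = if i = j then 1 else 0) →
          (gram (charBilin α₂ x) s).det ^ 2 = 1) ∧
      (∀ x, ∀ s : Fin q → TangentSpace (𝓡 n) x, (∀ i, s i ∈ charDistribution α₂ x) →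
        (∀ i j, g.inner x (s i) (s j) = if i = j then 1 else 0) →
          (gram (charBilin α₁ x) s).det ^ 2 = 1) := by
  obtain ⟨b, hbs, hsymm, hpos⟩ := exists_smooth_inner (n := n) (M := M)
  -- The orthogonal sum of the restrictions of `b` to the two distributions, each with its own
  -- factor.
  let G : ∀ x : M, TangentSpace (𝓡 n) x →L[ℝ] TangentSpace (𝓡 n) x →L[ℝ] ℝ := fun x ↦
    mkBilin (fun v w ↦ hα.scale b x * b x (hα.proj x v) (hα.proj x w) +
        hα.symm.scale b x * b x (hα.symm.proj x v) (hα.symm.proj x w))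
      (fun _ _ _ ↦ by simp only [map_add, add_apply]; ring)
      (fun _ _ _ ↦ by simp only [map_smul, FunLike.coe_smul, Pi.smul_apply, smul_eq_mul]; ring)
      (fun _ _ _ ↦ by simp only [map_add]; ring)
      (fun _ _ _ ↦ by simp only [map_smul, smul_eq_mul]; ring)
  have hG : ∀ x v w, G x v w = hα.scale b x * b x (hα.proj x v) (hα.proj x w) +
        hα.symm.scale b x * b x (hα.symm.proj x v) (hα.symm.proj x w) := fun _ _ _ ↦ rfl
  have hGpos : ∀ x v, v ≠ 0 → 0 < G x v v := by
    intro x v hv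
    have h1 := hα.scale_pos (hpos x)
    have h2 := hα.symm.scale_pos (hpos x)
    have hnn : ∀ u, 0 ≤ b x u u := fun u ↦ by
      rcases eq_or_ne u 0 with rfl | hu
      · rw [map_zero]
      · exact (hpos x u hu).le
    rw [hG]
    by_cases h : hα.proj x v = 0
    · have h3 : hα.symm.proj x v ≠ 0 := fun h4 ↦ hv (by
        rw [← hα.proj_add_proj_symm v, h, h4, add_zero])
      exact add_pos_of_nonneg_of_pos (mul_nonneg h1.le (hnn _)) (mul_pos h2 (hpos x _ h3))
    · exact add_pos_of_pos_of_nonneg (mul_pos h1 (hpos x _ h)) (mul_nonneg h2.le (hnn _))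
  have hGs : ∀ x, SmoothBilinAt G x := fun x ↦ smoothBilinAt_of_constField fun u v ↦ by
    have hc := fun u ↦ smoothFieldAt_constField (mem_extChartAt_source (I := 𝓡 n) x) u
    exact ((hα.contMDiffAt_scale hpos (hbs x)).mul
      ((hbs x).apply (hα.smoothFieldAt_proj (hc u)) (hα.smoothFieldAt_proj (hc v)))).add
      ((hα.symm.contMDiffAt_scale hpos (hbs x)).mul
      ((hbs x).apply (hα.symm.smoothFieldAt_proj (hc u)) (hα.symm.smoothFieldAt_proj (hc v))))
  refine ⟨⟨G, fun x v w ↦ ?_, hGpos, fun x ↦ ?_, fun x ↦ hGs x⟩, fun x v hv w hw ↦ ?_,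
    fun x s hs ho ↦ ?_, fun x s hs ho ↦ ?_⟩
  · rw [hG, hG, hsymm x (hα.proj x v), hsymm x (hα.symm.proj x v)]
  · exact isVonNBounded_of_pos (E := EuclideanSpace ℝ (Fin n)) (G x) (hGpos x)
  · change G x v w = 0
    rw [hG, hα.proj_of_mem_right hw, hα.symm.proj_of_mem_right hv, map_zero, map_zero]
    simp
  · refine hα.det_gram_charBilin_sq_eq_one hp (hpos x) hs fun i j ↦ ?_
    rw [← ho i j]
    change _ = G x (s i) (s j)
    rw [hG, hα.proj_of_mem (hs i), hα.proj_of_mem (hs j), hα.symm.proj_of_mem_right (hs i),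
      map_zero]
    simp
  · refine hα.symm.det_gram_charBilin_sq_eq_one hq (hpos x) hs fun i j ↦ ?_
    rw [← ho i j]
    change _ = G x (s i) (s j)
    rw [hG, hα.symm.proj_of_mem (hs i), hα.symm.proj_of_mem (hs j), hα.proj_of_mem_right (hs i),
      map_zero]
    simp

end IsComplementaryPair

end AdaptedMetric

/-! ### Existence of the Levi-Civita connection -/

section LeviCivita

open Module

/-- The Christoffel form of an inner product `G` whose derivative is `dG`. -/
theorem exists_christoffel {E : Type*} [AddCommGroup E] [Module ℝ E] [FiniteDimensional ℝ E]
    (G : E →ₗ[ℝ] E →ₗ[ℝ] ℝ) (hsymm : ∀ v w, G v w = G w v) (hpos : ∀ v, v ≠ 0 → 0 < G v v)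
    (dG : E →ₗ[ℝ] E →ₗ[ℝ] E →ₗ[ℝ] ℝ) (hd : ∀ u v w, dG u v w = dG u w v) :
    ∃ Γ : E →ₗ[ℝ] E →ₗ[ℝ] E, (∀ v w, Γ v w = Γ w v) ∧
      ∀ u v w, dG u v w = G (Γ u v) w + G v (Γ u w) := by
  have hinj : Function.Injective G := by
    rw [injective_iff_map_eq_zero]
    intro v hv
    by_contra hne
    have h := hpos v hne
    rw [hv, LinearMap.zero_apply] at h
    exact h.false
  let L : E ≃ₗ[ℝ] (E →ₗ[ℝ] ℝ) :=
    LinearMap.linearEquivOfInjective G hinj (Subspace.dual_finrank_eq (K := ℝ) (V := E)).symm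
  -- Koszul's formula for coordinate fields, whose brackets vanish.
  let K : E →ₗ[ℝ] E →ₗ[ℝ] E →ₗ[ℝ] ℝ := (2⁻¹ : ℝ) • LinearMap.mk₂ ℝ
    (fun u v ↦ dG u v + dG v u - (dG.flip u).flip v)
    (fun _ _ _ ↦ by ext; simp; ring) (fun _ _ _ ↦ by ext; simp; ring)
    (fun _ _ _ ↦ by ext; simp; ring) (fun _ _ _ ↦ by ext; simp; ring)
  have hK : ∀ u v w, K u v w = 2⁻¹ * (dG u v w + dG v u w - dG w u v) := fun _ _ _ ↦ rfl
  have hL : ∀ u v w, G (L.symm (K u v)) w = K u v w := fun u v w ↦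
    congrArg (fun f : E →ₗ[ℝ] ℝ ↦ f w) (L.apply_symm_apply (K u v))
  refine ⟨K.compr₂ L.symm.toLinearMap, fun v w ↦ ?_, fun u v w ↦ ?_⟩
  · refine congrArg L.symm (LinearMap.ext fun z ↦ ?_)
    rw [hK, hK, hd z v w]
    ring
  · change dG u v w = G (L.symm (K u v)) w + G v (L.symm (K u w))
    rw [hsymm v, hL, hL, hK, hK, hd u w v]
    ring

set_option synthInstance.maxHeartbeats 400000 in
theorem exists_christoffel_of_differentiableAt {E : Type*} [NormedAddCommGroup E]
    [NormedSpace ℝ E] [FiniteDimensional ℝ E] {G : E → E →L[ℝ] E →L[ℝ] ℝ} {z : E}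
    (hG : DifferentiableAt ℝ G z) (hsymm : ∀ z v w, G z v w = G z w v)
    (hpos : ∀ v, v ≠ 0 → 0 < G z v v) :
    ∃ Γ : E →ₗ[ℝ] E →ₗ[ℝ] E, (∀ v w, Γ v w = Γ w v) ∧
      ∀ u v w, fderiv ℝ G z u v w = G z (Γ u v) w + G z v (Γ u w) := by
  have hd : ∀ u v w, fderiv ℝ G z u v w = fderiv ℝ (fun z ↦ G z v w) z u := fun u v w ↦ by
    rw [((hG.hasFDerivAt.clm_apply (hasFDerivAt_const v _)).clm_apply
      (hasFDerivAt_const w _)).fderiv]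
    simp
  let T : (E →L[ℝ] ℝ) →ₗ[ℝ] E →ₗ[ℝ] ℝ := ContinuousLinearMap.coeLM ℝ
  let B : E →ₗ[ℝ] E →ₗ[ℝ] ℝ := T.comp (G z).toLinearMap
  let dG : E →ₗ[ℝ] E →ₗ[ℝ] E →ₗ[ℝ] ℝ :=
    LinearMap.mk₂ ℝ (fun u v ↦ T (fderiv ℝ G z u v))
      (fun u u' v ↦ by rw [map_add, add_apply, map_add])
      (fun c u v ↦ by rw [map_smul, smul_apply, map_smul])
      (fun u v v' ↦ by rw [map_add, map_add]) (fun c u v ↦ by rw [map_smul, map_smul])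
  exact exists_christoffel B (hsymm z) hpos dG fun u v w ↦
    (hd u v w).trans (Eq.trans (by simp only [hsymm _ v w]) (hd u w v).symm)

variable {n : ℕ} {M : Type*} [TopologicalSpace M] [ChartedSpace (EuclideanSpace ℝ (Fin n)) M]

theorem differentiableAt_comp_symm {F : Type*} [NormedAddCommGroup F] [NormedSpace ℝ F]
    {f : M → F} {x : M} (hf : MDifferentiableAt (𝓡 n) 𝓘(ℝ, F) f x) :
    DifferentiableAt ℝ (fun z ↦ f ((extChartAt (𝓡 n) x).symm z)) (extChartAt (𝓡 n) x x) := by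
  have h := hf.differentiableWithinAt_writtenInExtChartAt
  rw [ModelWithCorners.range_eq_univ, differentiableWithinAt_univ] at h
  exact h

variable [IsManifold (𝓡 n) ∞ M]

theorem constField_add (x y : M) (u v : EuclideanSpace ℝ (Fin n)) :
    constField x (u + v) y = constField x u y + constField x v y := map_add _ u v

theorem constField_smul (x y : M) (c : ℝ) (u : EuclideanSpace ℝ (Fin n)) :
    constField x (c • u) y = c • constField x u y := map_smul _ c u

/-- The coordinate expression of a bilinear form field in the chart at `x`. -/
def bilinInChart (b : ∀ x : M, TangentSpace (𝓡 n) x →L[ℝ] TangentSpace (𝓡 n) x →L[ℝ] ℝ) (x : M)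
    (z : EuclideanSpace ℝ (Fin n)) :
    EuclideanSpace ℝ (Fin n) →L[ℝ] EuclideanSpace ℝ (Fin n) →L[ℝ] ℝ :=
  (LinearMap.mk₂ ℝ (fun u v ↦ b ((extChartAt (𝓡 n) x).symm z)
      (constField x u ((extChartAt (𝓡 n) x).symm z)) (constField x v ((extChartAt (𝓡 n) x).symm z)))
    (fun _ _ _ ↦ by rw [constField_add, map_add]; rfl)
    (fun _ _ _ ↦ by rw [constField_smul, map_smul]; rfl)
    (fun _ _ _ ↦ by rw [constField_add, map_add])
    (fun _ _ _ ↦ by rw [constField_smul, map_smul])).toContinuousBilinearMap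

theorem bilinInChart_apply (b : ∀ x : M, TangentSpace (𝓡 n) x →L[ℝ] TangentSpace (𝓡 n) x →L[ℝ] ℝ)
    (x : M) (z u v : EuclideanSpace ℝ (Fin n)) : bilinInChart b x z u v =
      b ((extChartAt (𝓡 n) x).symm z) (constField x u ((extChartAt (𝓡 n) x).symm z))
        (constField x v ((extChartAt (𝓡 n) x).symm z)) := rfl

theorem bilinInChart_self (b : ∀ x : M, TangentSpace (𝓡 n) x →L[ℝ] TangentSpace (𝓡 n) x →L[ℝ] ℝ)
    (x : M) (u v : TangentSpace (𝓡 n) x) :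
    bilinInChart b x (extChartAt (𝓡 n) x x) u v = b x u v := by
  have h1 : ∀ p : M, p = x → b p (constField x u p) (constField x v p) = b x u v := by
    rintro p rfl
    exact congrArg₂ (fun u v ↦ b p u v) (constField_self p u) (constField_self p v)
  exact h1 _ (extChartAt_to_inv x)

set_option synthInstance.maxHeartbeats 400000 in
theorem SmoothBilinAt.contDiffAt_bilinInChart
    {b : ∀ x : M, TangentSpace (𝓡 n) x →L[ℝ] TangentSpace (𝓡 n) x →L[ℝ] ℝ} {x : M}
    (hb : SmoothBilinAt b x) :
    ContDiffAt ℝ ∞ (bilinInChart b x) (extChartAt (𝓡 n) x x) := by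
  rw [← contMDiffAt_iff_contDiffAt]
  refine contMDiffAt_clm_of_apply fun u ↦ contMDiffAt_clm_of_apply fun v ↦
    contMDiffAt_iff_contDiffAt.2 ?_
  have hc := fun u ↦ smoothFieldAt_constField (mem_extChartAt_source (I := 𝓡 n) x) u
  refine contDiffAt_comp_symm (f := fun y ↦ b y (constField x u y) (constField x v y))
    (mem_extChartAt_target x) ?_
  rw [extChartAt_to_inv]
  exact hb.apply (hc u) (hc v)

theorem differentiableAt_fieldInChart {X : ∀ x : M, TangentSpace (𝓡 n) x} {x : M}
    (hX : MDifferentiableAt (𝓡 n) ((𝓡 n).prod 𝓘(ℝ, EuclideanSpace ℝ (Fin n)))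
      (fun y ↦ TotalSpace.mk' (EuclideanSpace ℝ (Fin n)) y (X y)) x) :
    DifferentiableAt ℝ (fieldInChart X x) (extChartAt (𝓡 n) x x) := by
  have h := MDifferentiableWithinAt.differentiableWithinAt_mpullbackWithin_vectorField
    (mdifferentiableWithinAt_univ.2 hX)
  rw [preimage_univ, univ_inter, ModelWithCorners.range_eq_univ] at h
  refine (h.differentiableAt Filter.univ_mem).congr_of_eventuallyEq ?_
  filter_upwards [(isOpen_extChartAt_target x).mem_nhds (mem_extChartAt_target (I := 𝓡 n) x)]
    with z hz
  have h1 := mpullbackWithin_eq_fieldInChart X x hz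
  rw [ModelWithCorners.range_eq_univ] at h1
  exact h1.symm

theorem mdifferentiableAt_of_comp_symm {F : Type*} [NormedAddCommGroup F] [NormedSpace ℝ F]
    {f : M → F} {x : M} (hf : DifferentiableAt ℝ (fun z ↦ f ((extChartAt (𝓡 n) x).symm z))
      (extChartAt (𝓡 n) x x)) : MDifferentiableAt (𝓡 n) 𝓘(ℝ, F) f x := by
  have h : MDifferentiableAt (𝓡 n) 𝓘(ℝ, F)
      ((fun z ↦ f ((extChartAt (𝓡 n) x).symm z)) ∘ extChartAt (𝓡 n) x) x :=
    hf.mdifferentiableAt.comp x (mdifferentiableAt_extChartAt (mem_chart_source _ x))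
  refine h.congr_of_eventuallyEq ?_
  filter_upwards [(isOpen_extChartAt_source x).mem_nhds (mem_extChartAt_source (I := 𝓡 n) x)]
    with y hy
  exact congrArg f (((extChartAt (𝓡 n) x).left_inv hy).symm)

set_option synthInstance.maxHeartbeats 400000 in
theorem mfderiv_bilin_apply
    {b : ∀ x : M, TangentSpace (𝓡 n) x →L[ℝ] TangentSpace (𝓡 n) x →L[ℝ] ℝ} {x : M}
    (hb : SmoothBilinAt b x) {X Y : ∀ x : M, TangentSpace (𝓡 n) x}
    (hX : DifferentiableAt ℝ (fieldInChart X x) (extChartAt (𝓡 n) x x))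
    (hY : DifferentiableAt ℝ (fieldInChart Y x) (extChartAt (𝓡 n) x x))
    (v : TangentSpace (𝓡 n) x) :
    mfderiv (𝓡 n) 𝓘(ℝ, ℝ) (fun y ↦ b y (X y) (Y y)) x v =
      fderiv ℝ (bilinInChart b x) (extChartAt (𝓡 n) x x) v
        (fieldInChart X x (extChartAt (𝓡 n) x x)) (fieldInChart Y x (extChartAt (𝓡 n) x x)) +
      (bilinInChart b x (extChartAt (𝓡 n) x x)
        (fderiv ℝ (fieldInChart X x) (extChartAt (𝓡 n) x x) v)
        (fieldInChart Y x (extChartAt (𝓡 n) x x)) +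
      bilinInChart b x (extChartAt (𝓡 n) x x) (fieldInChart X x (extChartAt (𝓡 n) x x))
        (fderiv ℝ (fieldInChart Y x) (extChartAt (𝓡 n) x x) v)) := by
  have hG := hb.contDiffAt_bilinInChart.differentiableAt (by simp)
  have hev : (fun z ↦ b ((extChartAt (𝓡 n) x).symm z) (X ((extChartAt (𝓡 n) x).symm z))
      (Y ((extChartAt (𝓡 n) x).symm z))) =ᶠ[𝓝 (extChartAt (𝓡 n) x x)]
      fun z ↦ bilinInChart b x z (fieldInChart X x z) (fieldInChart Y x z) := by
    filter_upwards [(isOpen_extChartAt_target x).mem_nhds (mem_extChartAt_target (I := 𝓡 n) x)]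
      with z hz
    have hs := (extChartAt (𝓡 n) x).map_target hz
    rw [bilinInChart_apply, fieldInChart, fieldInChart, constField_tcoord hs, constField_tcoord hs]
  have hd := ((hG.hasFDerivAt.clm_apply hX.hasFDerivAt).clm_apply hY.hasFDerivAt)
  have hm := mdifferentiableAt_of_comp_symm (f := fun y ↦ b y (X y) (Y y))
    (hd.differentiableAt.congr_of_eventuallyEq hev)
  rw [mfderiv_eq_fderiv_chart hm, hev.fderiv_eq, hd.fderiv]
  have h : ∀ r s t : ℝ, t + (s + r) = r + (s + t) := fun _ _ _ ↦ by ring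
  exact Eq.trans rfl (h _ _ _)

/-- The covariant derivative with Christoffel form `Γ x` in the chart at `x`. -/
def covOfChristoffel
    (Γ : M → EuclideanSpace ℝ (Fin n) →ₗ[ℝ] EuclideanSpace ℝ (Fin n) →ₗ[ℝ]
      EuclideanSpace ℝ (Fin n))
    (X : ∀ x : M, TangentSpace (𝓡 n) x) (x : M) :
    TangentSpace (𝓡 n) x →L[ℝ] TangentSpace (𝓡 n) x :=
  (fderiv ℝ (fieldInChart X x) (extChartAt (𝓡 n) x x) +
    LinearMap.toContinuousLinearMap ((Γ x).flip (X x)) :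
      EuclideanSpace ℝ (Fin n) →L[ℝ] EuclideanSpace ℝ (Fin n))

theorem isCovariantDerivativeOn_covOfChristoffel
    (Γ : M → EuclideanSpace ℝ (Fin n) →ₗ[ℝ] EuclideanSpace ℝ (Fin n) →ₗ[ℝ]
      EuclideanSpace ℝ (Fin n)) :
    IsCovariantDerivativeOn (I := 𝓡 n) (M := M) (EuclideanSpace ℝ (Fin n))
      (V := (TangentSpace (𝓡 n) : M → Type _)) (covOfChristoffel Γ) univ where
  add {X Y x} hX hY _ := by
    have h1 := differentiableAt_fieldInChart hX
    have h2 := differentiableAt_fieldInChart hY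
    have h3 : fieldInChart (X + Y) x = fieldInChart X x + fieldInChart Y x :=
      funext fun z ↦ map_add _ _ _
    ext1 v
    have h4 : (Γ x v) ((X + Y) x) = Γ x v (X x) + Γ x v (Y x) := map_add (Γ x v) _ _
    have h5 := congrArg (fun f ↦ f v) (fderiv_add h1 h2)
    rw [← h3] at h5
    refine (congrArg₂ (· + ·) h5 h4).trans ?_
    exact add_add_add_comm _ _ _ _
  leibniz {X f x} hX hf _ := by
    have h1 := differentiableAt_fieldInChart hX
    have h2 := differentiableAt_comp_symm hf
    have h3 : fieldInChart (f • X) x =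
        fun z ↦ f ((extChartAt (𝓡 n) x).symm z) • fieldInChart X x z :=
      funext fun z ↦ map_smul (tcoord x ((extChartAt (𝓡 n) x).symm z)) _ _
    ext1 v
    have h4 : (Γ x v) ((f • X) x) = f x • Γ x v (X x) := map_smul (Γ x v) _ _
    have h5 := congrArg (fun L ↦ L v) (fderiv_fun_smul h2 h1)
    rw [← h3] at h5
    have h6 : (fderiv ℝ (fieldInChart (f • X) x) (extChartAt (𝓡 n) x x) v :
        EuclideanSpace ℝ (Fin n)) =
        f x • fderiv ℝ (fieldInChart X x) (extChartAt (𝓡 n) x x) v +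
          (fderiv ℝ (fun z ↦ f ((extChartAt (𝓡 n) x).symm z)) (extChartAt (𝓡 n) x x) v : ℝ) •
            fieldInChart X x (extChartAt (𝓡 n) x x) := by
      refine h5.trans ?_
      have h7 : f ((extChartAt (𝓡 n) x).symm (extChartAt (𝓡 n) x x)) = f x :=
        congrArg f (extChartAt_to_inv x)
      rw [h7]
      rfl
    rw [fieldInChart_self] at h6
    refine (congrArg₂ (fun a b : EuclideanSpace ℝ (Fin n) ↦ a + b) h6 h4).trans ?_
    have h8 : ∀ (c : ℝ) (a b d : EuclideanSpace ℝ (Fin n)),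
        (c • a + d) + c • b = c • (a + b) + d := fun c a b d ↦ by module
    refine (h8 _ _ _ _).trans ?_
    have h9 : ∀ (r s : ℝ) (a b : EuclideanSpace ℝ (Fin n)), r = s → a + r • b = a + s • b :=
      fun r s a b h ↦ by rw [h]
    exact h9 _ _ _ _ (mfderiv_eq_fderiv_chart hf v).symm

/-- The covariant derivative with Christoffel form `Γ x` in the chart at `x`. -/
def covariantDerivativeOfChristoffel
    (Γ : M → EuclideanSpace ℝ (Fin n) →ₗ[ℝ] EuclideanSpace ℝ (Fin n) →ₗ[ℝ]
      EuclideanSpace ℝ (Fin n)) :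
    CovariantDerivative (𝓡 n) (EuclideanSpace ℝ (Fin n)) (TangentSpace (𝓡 n) : M → Type _) :=
  ⟨covOfChristoffel Γ, isCovariantDerivativeOn_covOfChristoffel Γ⟩

/-- In the chart at x the bracket is the antisymmetrized derivative, so the torsion is the
antisymmetric part of Γ. -/
theorem torsion_covariantDerivativeOfChristoffel
    {Γ : M → EuclideanSpace ℝ (Fin n) →ₗ[ℝ] EuclideanSpace ℝ (Fin n) →ₗ[ℝ]
      EuclideanSpace ℝ (Fin n)} (hΓ : ∀ x v w, Γ x v w = Γ x w v) :
    (covariantDerivativeOfChristoffel Γ).torsion = 0 := by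
  rw [CovariantDerivative.torsion_eq_zero_iff]
  intro X Y x hX hY
  rw [mlieBracket_eq_lieBracket]
  have h : ∀ a b c : EuclideanSpace ℝ (Fin n), (a + c) - (b + c) = a - b :=
    fun a b c ↦ by abel
  have h1 := h (fderiv ℝ (fieldInChart Y x) (extChartAt (𝓡 n) x x) (X x))
    (fderiv ℝ (fieldInChart X x) (extChartAt (𝓡 n) x x) (Y x)) (Γ x (X x) (Y x))
  refine Eq.trans ?_ (h1.trans ?_)
  · exact congrArg (fun a : EuclideanSpace ℝ (Fin n) ↦
      fderiv ℝ (fieldInChart Y x) (extChartAt (𝓡 n) x x) (X x) + Γ x (X x) (Y x) -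
        (fderiv ℝ (fieldInChart X x) (extChartAt (𝓡 n) x x) (Y x) + a)) (hΓ x (Y x) (X x))
  · exact congrArg₂ (fun u v : EuclideanSpace ℝ (Fin n) ↦
      fderiv ℝ (fieldInChart Y x) (extChartAt (𝓡 n) x x) u -
        fderiv ℝ (fieldInChart X x) (extChartAt (𝓡 n) x x) v) (fieldInChart_self X x).symm
        (fieldInChart_self Y x).symm

theorem exists_christoffel_inChart (g : Metric n M) (x : M) :
    ∃ Γ : EuclideanSpace ℝ (Fin n) →ₗ[ℝ] EuclideanSpace ℝ (Fin n) →ₗ[ℝ] EuclideanSpace ℝ (Fin n),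
      (∀ v w, Γ v w = Γ w v) ∧ ∀ u v w : EuclideanSpace ℝ (Fin n),
        fderiv ℝ (bilinInChart g.inner x) (extChartAt (𝓡 n) x x) u v w =
          bilinInChart g.inner x (extChartAt (𝓡 n) x x) (Γ u v) w +
            bilinInChart g.inner x (extChartAt (𝓡 n) x x) v (Γ u w) := by
  have hb : SmoothBilinAt g.inner x := g.contMDiff x
  refine exists_christoffel_of_differentiableAt
    (hb.contDiffAt_bilinInChart.differentiableAt (by simp)) (fun z v w ↦ g.symm _ _ _)
    fun v hv ↦ ?_
  exact (g.pos x v hv).trans_eq (bilinInChart_self g.inner x v v).symm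

/-- Existence of the Levi-Civita connection. -/
theorem exists_isLeviCivita (g : Metric n M) :
    ∃ cov : CovariantDerivative (𝓡 n) (EuclideanSpace ℝ (Fin n))
      (TangentSpace (𝓡 n) : M → Type _), IsLeviCivita g cov := by
  -- The value of ∇ at x uses only the chart at x and `Γ x`, and the axioms are pointwise; no
  -- regularity of Γ in x is required.
  choose Γ hΓ hg using exists_christoffel_inChart g
  refine ⟨covariantDerivativeOfChristoffel Γ, torsion_covariantDerivativeOfChristoffel hΓ,
    fun x v Y Z hY hZ ↦ ?_⟩
  have hb : SmoothBilinAt g.inner x := g.contMDiff x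
  refine (mfderiv_bilin_apply hb (differentiableAt_fieldInChart hY)
    (differentiableAt_fieldInChart hZ) v).trans ?_
  rw [hg x v]
  refine Eq.trans ?_ (congrArg₂ (fun r s : ℝ ↦ r + s)
    (bilinInChart_self g.inner x (covOfChristoffel Γ Y x v) (Z x))
    (bilinInChart_self g.inner x (Y x) (covOfChristoffel Γ Z x v)))
  have h : ∀ (B : EuclideanSpace ℝ (Fin n) →L[ℝ] EuclideanSpace ℝ (Fin n) →L[ℝ] ℝ)
      (y z a b c d : EuclideanSpace ℝ (Fin n)),
      B a z + B y b + (B c z + B y d) = B (c + a) z + B y (d + b) := fun B y z a b c d ↦ by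
    rw [map_add, map_add, add_apply]
    ring
  refine (h _ _ _ _ _ _ _).trans ?_
  exact congrArg₂ (fun y z : EuclideanSpace ℝ (Fin n) ↦
    bilinInChart g.inner x (extChartAt (𝓡 n) x x)
      (fderiv ℝ (fieldInChart Y x) (extChartAt (𝓡 n) x x) v + Γ x v y) z +
    bilinInChart g.inner x (extChartAt (𝓡 n) x x) y
      (fderiv ℝ (fieldInChart Z x) (extChartAt (𝓡 n) x x) v + Γ x v z))
    (fieldInChart_self Y x) (fieldInChart_self Z x)

end LeviCivita

/-! ### Jacobi's formula and the trace identity -/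

section Determinant

open Matrix

variable {p : ℕ}

/-- Jacobi's formula. -/
theorem hasFDerivAt_det {E : Type*} [NormedAddCommGroup E] [NormedSpace ℝ E]
    {A : E → Matrix (Fin p) (Fin p) ℝ} {A' : Fin p → Fin p → E →L[ℝ] ℝ} {z : E}
    (hA : ∀ i j, HasFDerivAt (fun y ↦ A y i j) (A' i j) z) :
    HasFDerivAt (fun y ↦ (A y).det) (∑ i, ∑ j, (A z).adjugate j i • A' i j) z := by
  let f : ContinuousMultilinearMap ℝ (fun _ : Fin p ↦ Fin p → ℝ) ℝ :=
    ⟨(detRowAlternating (R := ℝ) (n := Fin p)).toMultilinearMap,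
      Continuous.matrix_det (A := fun B : Fin p → Fin p → ℝ ↦ Matrix.of B) continuous_id⟩
  have h1 : HasFDerivAt (fun y i j ↦ A y i j)
      (ContinuousLinearMap.pi fun i ↦ ContinuousLinearMap.pi fun j ↦ A' i j) z :=
    hasFDerivAt_pi.2 fun i ↦ hasFDerivAt_pi.2 fun j ↦ hA i j
  refine ((f.hasFDerivAt (x := fun i j ↦ A z i j)).comp z h1).congr_fderiv ?_
  ext u
  -- The determinant is multilinear in the rows, so its derivative replaces one row at a time;
  -- Cramer's rule expands each term through the adjugate.
  have h2 : ∀ i, ((A z).updateRow i fun j ↦ A' i j u).det =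
      ∑ j, (A z).adjugate j i * A' i j u := fun i ↦ by
    rw [← cramer_transpose_apply, cramer_eq_adjugate_mulVec, mulVec, dotProduct,
      ← adjugate_transpose]
    rfl
  have h3 : (∑ i, ∑ j, (A z).adjugate j i • A' i j) u =
      ∑ i, ((A z).updateRow i fun j ↦ A' i j u).det := by
    simp [h2]
  rw [h3, ContinuousLinearMap.comp_apply, ContinuousMultilinearMap.linearDeriv_apply]
  rfl

theorem sum_adjugate_mul (A S : Matrix (Fin p) (Fin p) ℝ) :
    ∑ i, ∑ j, S.adjugate j i * (A * S + S * Aᵀ) i j = 2 * S.det * A.trace := by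
  have h : ∑ i, ∑ j, S.adjugate j i * (A * S + S * Aᵀ) i j =
      ((A * S + S * Aᵀ) * S.adjugate).trace := by
    simp only [trace, diag_apply, mul_apply (M := A * S + S * Aᵀ), mul_comm (S.adjugate _ _)]
  rw [h, add_mul, trace_add, mul_assoc, mul_adjugate, trace_mul_comm (S * Aᵀ), ← mul_assoc,
    adjugate_mul]
  simp
  ring

variable {n : ℕ} {M : Type*} [TopologicalSpace M] [ChartedSpace (EuclideanSpace ℝ (Fin n)) M]

/-- With S' = A S + S Aᵀ, Jacobi's formula gives (det S)' = 2 det S · tr A. Since (det S)² is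
constant and nonzero, tr A = 0. -/
theorem trace_eq_zero_of_det_sq_eq_one {S : M → Matrix (Fin p) (Fin p) ℝ} {x : M}
    (hS : ∀ i j, MDifferentiableAt (𝓡 n) 𝓘(ℝ, ℝ) (fun y ↦ S y i j) x)
    (hdet : ∀ᶠ y in 𝓝 x, (S y).det ^ 2 = 1) {v : TangentSpace (𝓡 n) x}
    {A : Matrix (Fin p) (Fin p) ℝ}
    (hA : ∀ i j, mfderiv (𝓡 n) 𝓘(ℝ, ℝ) (fun y ↦ S y i j) x v = (A * S x + S x * Aᵀ) i j) :
    A.trace = 0 := by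
  let z₀ := extChartAt (𝓡 n) x x
  have hx : (extChartAt (𝓡 n) x).symm z₀ = x := extChartAt_to_inv x
  have h1 := hasFDerivAt_det fun i j ↦ (differentiableAt_comp_symm (hS i j)).hasFDerivAt
  have h2 : (fun z ↦ (S ((extChartAt (𝓡 n) x).symm z)).det ^ 2) =ᶠ[𝓝 z₀] fun _ ↦ (1 : ℝ) := by
    have hc := continuousAt_extChartAt_symm (I := 𝓡 n) x
    rw [ContinuousAt, extChartAt_to_inv] at hc
    exact hc.eventually hdet
  have h3 := (h1.pow 2).unique ((hasFDerivAt_const (1 : ℝ) z₀).congr_of_eventuallyEq h2)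
  have h4 := congrArg (fun L : EuclideanSpace ℝ (Fin n) →L[ℝ] ℝ ↦ L v) h3
  have h5 : (S x).det ^ 2 = 1 := hdet.self_of_nhds
  have h6 : (∑ i, ∑ j, (S x).adjugate j i * (A * S x + S x * Aᵀ) i j) = 0 := by
    have h7 : 2 * (S x).det * ∑ i, ∑ j, (S x).adjugate j i *
        fderiv ℝ (fun z ↦ S ((extChartAt (𝓡 n) x).symm z) i j) (extChartAt (𝓡 n) x x) v = 0 := by
      have h8 : ∀ w, w = x → 2 * (S w).det * ∑ i, ∑ j, (S w).adjugate j i *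
          fderiv ℝ (fun z ↦ S ((extChartAt (𝓡 n) x).symm z) i j) (extChartAt (𝓡 n) x x) v =
          2 * (S x).det * ∑ i, ∑ j, (S x).adjugate j i *
          fderiv ℝ (fun z ↦ S ((extChartAt (𝓡 n) x).symm z) i j) (extChartAt (𝓡 n) x x) v := by
        rintro w rfl
        rfl
      rw [← h8 _ hx]
      have hsum : ∀ (c : ℝ) (a : Matrix (Fin p) (Fin p) ℝ)
          (L : Fin p → Fin p → EuclideanSpace ℝ (Fin n) →L[ℝ] ℝ) (u : EuclideanSpace ℝ (Fin n)),
          ((2 • c ^ (2 - 1)) • ∑ i, ∑ j, a j i • L i j : EuclideanSpace ℝ (Fin n) →L[ℝ] ℝ) u =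
            2 * c * ∑ i, ∑ j, a j i * L i j u := fun c a L u ↦ by simp
      exact (hsum _ _ _ _).symm.trans h4
    have h9 : 2 * (S x).det ≠ 0 := fun h ↦ by
      rw [mul_eq_zero_iff_left two_ne_zero] at h
      simp [h] at h5
    refine Eq.trans ?_ ((mul_eq_zero_iff_left h9).1 h7)
    refine Finset.sum_congr rfl fun i _ ↦ Finset.sum_congr rfl fun j _ ↦ ?_
    exact congrArg _ ((hA i j).symm.trans (mfderiv_eq_fderiv_chart (hS i j) v))
  rw [sum_adjugate_mul] at h6
  have h7 : (S x).det ≠ 0 := fun h ↦ by simp [h] at h5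
  simpa [h7] using h6

end Determinant

/-! ### Vanishing of the mean curvature -/

section Minimality

open VectorField

variable {n : ℕ} {M : Type*} [TopologicalSpace M] [ChartedSpace (EuclideanSpace ℝ (Fin n)) M]
  [IsManifold (𝓡 n) ∞ M]

theorem SmoothFieldAt.mdifferentiableAt {X : ∀ x : M, TangentSpace (𝓡 n) x} {x : M}
    (hX : SmoothFieldAt X x) :
    MDifferentiableAt (𝓡 n) ((𝓡 n).prod 𝓘(ℝ, EuclideanSpace ℝ (Fin n)))
      (fun y ↦ TotalSpace.mk' (EuclideanSpace ℝ (Fin n)) y (X y)) x :=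
  ContMDiffAt.mdifferentiableAt hX (by simp)

/-- If `N` is orthogonal to the unit field `X`, then `g([N, X], X) = g(N, ∇_X X)`. -/
theorem IsLeviCivita.inner_mlieBracket {g : Metric n M}
    {cov : CovariantDerivative (𝓡 n) (EuclideanSpace ℝ (Fin n))
      (TangentSpace (𝓡 n) : M → Type _)} (hcov : IsLeviCivita g cov)
    {N X : ∀ x : M, TangentSpace (𝓡 n) x} {x : M} (hN : SmoothFieldAt N x)
    (hX : SmoothFieldAt X x) (hXX : ∀ᶠ y in 𝓝 x, g.inner y (X y) (X y) = 1)
    (hNX : ∀ᶠ y in 𝓝 x, g.inner y (N y) (X y) = 0) :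
    g.inner x (mlieBracket (𝓡 n) N X x) (X x) = g.inner x (N x) (cov X x (X x)) := by
  have h1 := hcov.metric x (N x) X X hX.mdifferentiableAt hX.mdifferentiableAt
  have h2 := hcov.metric x (X x) N X hN.mdifferentiableAt hX.mdifferentiableAt
  have e1 : (fun y ↦ g.inner y (X y) (X y)) =ᶠ[𝓝 x] fun _ ↦ (1 : ℝ) := hXX
  have e2 : (fun y ↦ g.inner y (N y) (X y)) =ᶠ[𝓝 x] fun _ ↦ (0 : ℝ) := hNX
  rw [e1.mfderiv_eq, mfderiv_const] at h1
  rw [e2.mfderiv_eq, mfderiv_const] at h2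
  have h1' : (0 : ℝ) = g.inner x (cov X x (N x)) (X x) + g.inner x (X x) (cov X x (N x)) := h1
  have h2' : (0 : ℝ) = g.inner x (cov N x (X x)) (X x) + g.inner x (N x) (cov X x (X x)) := h2
  rw [g.symm x (X x)] at h1'
  -- Here [N, X] = ∇_N X − ∇_X N: the first term is orthogonal to X by `h1'`, and `h2'` moves the
  -- derivative in the second from N to X.
  have h3 := cov.torsion_eq_zero_iff.1 hcov.torsion_eq_zero hN.mdifferentiableAt
    hX.mdifferentiableAt
  rw [← h3, map_sub, sub_apply]
  linarith

namespace IsComplementaryPair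

variable {p q : ℕ} {α₁ α₂ : ∀ x : M, TangentSpace (𝓡 n) x →L[ℝ] ℝ}

theorem mem_of_inner_eq_zero (hα : IsComplementaryPair p q α₁ α₂) {g : Metric n M}
    (hg : ∀ x, ∀ v ∈ charDistribution α₁ x, ∀ w ∈ charDistribution α₂ x, g.inner x v w = 0)
    {x : M} {ν : TangentSpace (𝓡 n) x} (hν : ∀ w ∈ charDistribution α₁ x, g.inner x ν w = 0) :
    ν ∈ charDistribution α₂ x := by
  have h1 : g.inner x (hα.proj x ν) (hα.proj x ν) = 0 := by
    have h2 := hν _ (hα.proj_mem ν)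
    nth_rw 1 [← hα.proj_add_proj_symm ν] at h2
    rwa [map_add, add_apply, g.symm x (hα.symm.proj x ν),
      hg x _ (hα.proj_mem ν) _ (hα.symm.proj_mem ν), add_zero] at h2
  have h2 : hα.proj x ν = 0 := by
    by_contra hne
    exact (g.pos x _ hne).ne' h1
  rw [← hα.proj_add_proj_symm ν, h2, zero_add]
  exact hα.symm.proj_mem ν

/-- The expansion of the projection to a distribution in an orthonormal frame. -/
theorem sum_inner_smul (hα : IsComplementaryPair p q α₁ α₂) {g : Metric n M}
    (hg : ∀ x, ∀ v ∈ charDistribution α₁ x, ∀ w ∈ charDistribution α₂ x, g.inner x v w = 0)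
    {x : M} {s : Fin p → TangentSpace (𝓡 n) x} (hs : ∀ i, s i ∈ charDistribution α₁ x)
    (ho : ∀ i j, g.inner x (s i) (s j) = if i = j then 1 else 0) (v : TangentSpace (𝓡 n) x) :
    ∑ i, g.inner x v (s i) • s i = hα.proj x v := by
  have hli : LinearIndependent ℝ s := Fintype.linearIndependent_iff.2 fun c hc j ↦ by
    have h := congrArg (fun w ↦ g.inner x (s j) w) hc
    simpa [map_sum, ho] using h
  have hmem : hα.proj x v ∈ Submodule.span ℝ (range s) := by
    rw [hα.span_eq hli hs]
    exact hα.proj_mem v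
  obtain ⟨c, hc⟩ := (Submodule.mem_span_range_iff_exists_fun ℝ).1 hmem
  rw [← hc]
  refine Finset.sum_congr rfl fun i _ ↦ ?_
  congr 1
  have h : g.inner x v (s i) = g.inner x (s i) (hα.proj x v) := by
    conv_lhs => rw [← hα.proj_add_proj_symm v]
    rw [g.symm, map_add, hg x _ (hs i) _ (hα.symm.proj_mem v), add_zero]
  rw [h, ← hc]
  simp [map_sum, ho]

/-- If the form `α₂ ⊗ α₂ + dα₂` has determinant `± 1` in all orthonormal frames of the first
characteristic distribution, then the leaves of the first characteristic foliation are minimal. -/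
theorem isMinimalFoliation (hα : IsComplementaryPair p q α₁ α₂) {g : Metric n M}
    (hg : ∀ x, ∀ v ∈ charDistribution α₁ x, ∀ w ∈ charDistribution α₂ x, g.inner x v w = 0)
    (hdet : ∀ x, ∀ s : Fin p → TangentSpace (𝓡 n) x, (∀ i, s i ∈ charDistribution α₁ x) →
      (∀ i j, g.inner x (s i) (s j) = if i = j then 1 else 0) →
        (gram (charBilin α₂ x) s).det ^ 2 = 1) :
    IsMinimalFoliation g (charDistribution α₁) p := by
  obtain ⟨cov, hcov⟩ := exists_isLeviCivita g
  refine ⟨hα.isFoliation, cov, hcov, fun U hU e he heD ho x hx ν hν ↦ ?_⟩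
  have hν₂ := hα.mem_of_inner_eq_zero hg hν
  -- The normal vector extended to a smooth section of the second distribution, along which β₂ is
  -- invariant.
  let N : ∀ y : M, TangentSpace (𝓡 n) y := fun y ↦ hα.symm.proj y (constField x ν y)
  have hNx : N x = ν :=
    (congrArg (hα.symm.proj x) (constField_self x ν)).trans (hα.symm.proj_of_mem hν₂)
  have hN : SmoothFieldAt N x :=
    hα.symm.smoothFieldAt_proj (smoothFieldAt_constField (mem_extChartAt_source x) _)
  have hND : ∀ y, N y ∈ charDistribution α₂ y := fun y ↦ hα.symm.proj_mem _
  have hex : ∀ i, SmoothFieldAt (e i) x := fun i ↦ (he i).smoothFieldAt hU hx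
  have hUx : U ∈ 𝓝 x := hU.mem_nhds hx
  let A : Matrix (Fin p) (Fin p) ℝ :=
    Matrix.of fun i k ↦ g.inner x (mlieBracket (𝓡 n) N (e i) x) (e k x)
  -- β₂ sees only the component of [N, eᵢ] in the first distribution, whose coefficients in the
  -- orthonormal frame are the row `A i`. `hsum'` is the same for the other slot.
  have hsum : ∀ i w, charBilin α₂ x (mlieBracket (𝓡 n) N (e i) x) w =
      ∑ k, A i k * charBilin α₂ x (e k x) w := fun i w ↦ by
    rw [← hα.charBilin_proj, ← hα.sum_inner_smul hg (fun k ↦ heD k x hx) (fun i j ↦ ho i j x hx)]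
    simp [map_sum, A]
  have hsum' : ∀ i w, charBilin α₂ x w (mlieBracket (𝓡 n) N (e i) x) =
      ∑ k, A i k * charBilin α₂ x w (e k x) := fun i w ↦ by
    rw [← hα.proj_add_proj_symm (mlieBracket (𝓡 n) N (e i) x), map_add,
      charBilin_right (hα.symm.proj_mem _), add_zero,
      ← hα.sum_inner_smul hg (fun k ↦ heD k x hx) (fun i j ↦ ho i j x hx)]
    simp [map_sum, A]
  have htr : A.trace = 0 := by
    refine trace_eq_zero_of_det_sq_eq_one (S := fun y ↦ gram (charBilin α₂ y) fun i ↦ e i y)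
      (x := x) (v := N x) (fun i j ↦ ?_) ?_ fun i j ↦ ?_
    · exact ((smoothBilinAt_charBilin hα.smooth₂ x).apply (hex i) (hex j)).mdifferentiableAt
        (by simp)
    · filter_upwards [hUx] with y hy
      exact hdet y _ (fun i ↦ heD i y hy) fun i j ↦ ho i j y hy
    · refine (mfderiv_charBilin_apply hα.smooth₂ hN (hex i) (hex j)
        (Filter.Eventually.of_forall hND)).trans ?_
      rw [hsum, hsum', Matrix.add_apply, Matrix.mul_apply, Matrix.mul_apply]
      refine congrArg₂ (· + ·) rfl (Finset.sum_congr rfl fun k _ ↦ ?_)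
      exact mul_comm _ _
  -- The diagonal of A consists of the normal components of the ∇_{eᵢ} eᵢ, so its trace is the mean
  -- curvature paired with ν.
  have hterm : ∀ i, g.inner x (cov (e i) x (e i x)) ν = A i i := fun i ↦ by
    rw [g.symm, ← hNx]
    refine (hcov.inner_mlieBracket hN (hex i) ?_ ?_).symm
    · filter_upwards [hUx] with y hy
      simpa using ho i i y hy
    · filter_upwards [hUx] with y hy
      rw [g.symm]
      exact hg y _ (heD i y hy) _ (hND y)
  have hfin : g.inner x (∑ i, cov (e i) x (e i x)) ν = ∑ i, A i i := by
    rw [map_sum, sum_apply]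
    exact Finset.sum_congr rfl fun i _ ↦ hterm i
  exact hfin.trans htr

end IsComplementaryPair

end Minimality

end ContactPair

end

theorem mainTheorem3 (n h k : ℕ) (M : Type*) [TopologicalSpace M] [T2Space M]
    [SecondCountableTopology M] [ChartedSpace (EuclideanSpace ℝ (Fin n)) M]
    [IsManifold (𝓡 n) ∞ M]
    (α₁ α₂ : ∀ x : M, TangentSpace (𝓡 n) x →L[ℝ] ℝ)
    (hα : ContactPair.IsContactPair h k α₁ α₂) :
    ∃ g : ContactPair.Metric n M,
      (∀ x : M, ∀ v ∈ ContactPair.charDistribution α₁ x,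
        ∀ w ∈ ContactPair.charDistribution α₂ x, g.inner x v w = 0) ∧
      ContactPair.IsMinimalFoliation g (ContactPair.charDistribution α₁) (2 * k + 1) ∧
      ContactPair.IsMinimalFoliation g (ContactPair.charDistribution α₂) (2 * h + 1) := by
  have hc := hα.isComplementaryPair
  -- Both ranks are odd, hence nonzero.
  obtain ⟨g, hg, h₁, h₂⟩ := hc.exists_metric (by omega) (by omega)
  exact ⟨g, hg, hc.isMinimalFoliation hg h₁, hc.symm.isMinimalFoliation
    (fun x v hv w hw ↦ (g.symm x v w).trans (hg x w hw v hv)) h₂⟩
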